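/- Let $n\ge 2$, $\sigma=\frac{n-1}2$, and let $\omega_{d-1}$ be the area of the unit sphere $S^{d-1}\subset\mathbb R^d$ ($\omega_0=2$). Let $\mathbb H^n$ be $n$-dimensional hyperbolic space (constant curvature $-1$), in the hyperboloid model, with distance $d$ and exponential maps $\exp_x:T_x\mathbb H^n\to\mathbb H^n$. For $\lambda=\sigma^2+\alpha^2$, $\alpha\ge 0$, let $$F_{n,\lambda}(r)=\frac{\omega_{n-2}}{\omega_{n-1}}\int_0^\pi(\cosh r-\sinh r\cos\theta)^{-\sigma+i\alpha}(\sin\theta)^{n-2}\,d\theta ,$$ and let the hyperbolic random wave $u_\lambda$ be the Gaussian random field on $\mathbb H^n$ with $\mathbb E[u_\lambda(x)]=0$ and $\mathbb E[u_\lambda(x)u_\lambda(y)]=F_{n,\lambda}(d(x,y))$ for all $x,y\in\mathbb H^n$. Fix $x\in\mathbb H^n$ and identify $T_x\mathbb H^n$ with $\mathbb R^n$ by a linear isometry. For every $\lambda\ge\sigma^2$, the covariance function of the pullback wave $v\mapsto u_\lambda(\exp_x(v/\sqrt\lambda))$ on $\mathbb R^n$ is $$C^H_{n,\lambda}(v,v')=F_{n,\lambda}\Big(d\Big(\exp_x\frac{v}{\sqrt\lambda},\exp_x\frac{v'}{\sqrt\lambda}\Big)\Big),\qquad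 v,v'\in\mathbb R^n .$$ Let $C_{n,1}(v,v')=\frac1{\omega_{n-1}}\int_{S^{n-1}}e^{i\,\vartheta\cdot(v-v')}\,d\vartheta$ be the covariance function of Berry's Euclidean random wave on $\mathbb R^n$ with frequency $1$; it is the Bessel kernel $$C_{n,1}(v,v')=\frac{(2\pi)^{n/2}}{\omega_{n-1}}\,|v-v'|^{1-n/2}\,J_{n/2-1}(|v-v'|),\qquad v\ne v',$$ where $J_\nu(z)=(z/2)^\nu\sum_{k\ge0}\frac{(-z^2/4)^k}{k!\,\Gamma(\nu+k+1)}$. If $r_\lambda=o(\sqrt\lambda)$ as $\lambda\to\infty$, then $$\sup_{v,v'\in\mathbb R^n:\ |v|,|v'|<r_\lambda}\big|C^H_{n,\lambda}(v,v')-C_{n,1}(v,v')\big|\longrightarrow 0,\qquad \lambda\to\infty .$$ -/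

import Mathlib

open MeasureTheory ProbabilityTheory Filter Topology

noncomputable section

namespace HypWave

/-- Ambient space `ℝ^{1+n}`, points written `(x₀, x')`. -/
abbrev Ambient (n : ℕ) : Type := ℝ × EuclideanSpace ℝ (Fin n)

/-- The Minkowski form `[x, y] = x₀ y₀ - x₁ y₁ - ... - xₙ yₙ`. -/
def mink {n : ℕ} (x y : Ambient n) : ℝ := x.1 * y.1 - inner ℝ x.2 y.2

/-- Hyperbolic space: the sheet `x₀ > 0` of the hyperboloid `[x, x] = 1`. -/
def Hyp (n : ℕ) : Type := {x : Ambient n // mink x x = 1 ∧ 0 < x.1}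

/-- The Riemannian distance `cosh⁻¹ [x, y]`. -/
def hdist {n : ℕ} (x y : Hyp n) : ℝ := Real.arcosh (mink x.1 y.1)

/-- The tangent space at `x` as a subspace of the ambient space: the vectors with `[x, w] = 0`. -/
def tangentSubmodule {n : ℕ} (x : Hyp n) : Submodule ℝ (Ambient n) where
  carrier := {w | mink x.1 w = 0}
  zero_mem' := by simp [mink]
  add_mem' := by
    intro a b ha hb
    simp only [mink, Set.mem_ofPred_eq, Prod.fst_add, Prod.snd_add, inner_add_right] at *
    linarith
  smul_mem' := by
    intro c a ha
    simp only [mink, Set.mem_ofPred_eq, Prod.smul_fst, Prod.smul_snd, inner_smul_right,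
      smul_eq_mul] at *
    linear_combination c * ha

/-- The tangent space at `x`, as a type of its own: its norm is the Riemannian one (below), not
the norm of the ambient product. -/
def Tangent {n : ℕ} (x : Hyp n) : Type := ↥(tangentSubmodule x)

instance {n : ℕ} (x : Hyp n) : AddCommGroup (Tangent x) :=
  inferInstanceAs (AddCommGroup ↥(tangentSubmodule x))

instance {n : ℕ} (x : Hyp n) : Module ℝ (Tangent x) :=
  inferInstanceAs (Module ℝ ↥(tangentSubmodule x))

/-- The inclusion of the tangent space in the ambient space. -/
def Tangent.incl {n : ℕ} (x : Hyp n) : Tangent x →ₗ[ℝ] Ambient n := (tangentSubmodule x).subtype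

theorem Tangent.incl_injective {n : ℕ} (x : Hyp n) : Function.Injective (Tangent.incl x) :=
  Subtype.val_injective

theorem mink_incl {n : ℕ} (x : Hyp n) (w : Tangent x) : mink x.1 (Tangent.incl x w) = 0 := w.2

theorem fst_sq_le {n : ℕ} (x : Hyp n) (w : Tangent x) :
    (Tangent.incl x w).1 ^ 2 ≤
      (x.1.1 ^ 2 - 1) * -mink (Tangent.incl x w) (Tangent.incl x w) := by
  have h1 := mink_incl x w
  have h2 := x.2.1
  have h3 := real_inner_mul_inner_self_le x.1.2 (Tangent.incl x w).2
  simp only [mink] at *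
  have e1 : inner ℝ x.1.2 x.1.2 = x.1.1 ^ 2 - 1 := by linarith
  have e2 : inner ℝ x.1.2 (Tangent.incl x w).2 = x.1.1 * (Tangent.incl x w).1 := by linarith
  rw [e1, e2] at h3
  nlinarith

theorem one_le_fst_sq {n : ℕ} (x : Hyp n) : 1 ≤ x.1.1 ^ 2 := by
  have h2 := x.2.1
  have : 0 ≤ inner ℝ x.1.2 x.1.2 := real_inner_self_nonneg
  simp only [mink] at h2
  nlinarith

theorem neg_mink_nonneg {n : ℕ} (x : Hyp n) (w : Tangent x) :
    0 ≤ -mink (Tangent.incl x w) (Tangent.incl x w) := by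
  have h1 := fst_sq_le x w
  have h2 := one_le_fst_sq x
  by_contra h
  push Not at h
  have h4 : 0 ≤ inner ℝ (Tangent.incl x w).2 (Tangent.incl x w).2 := real_inner_self_nonneg
  have h5 : (Tangent.incl x w).1 ^ 2 ≤ 0 := by nlinarith
  simp only [mink] at h
  nlinarith

/-- The Riemannian metric of the hyperboloid, induced by
`-dx₀² + dx₁² + ... + dxₙ²`. -/
@[reducible] def tangentCore {n : ℕ} (x : Hyp n) : InnerProductSpace.Core ℝ (Tangent x) where
  inner v w := -mink (Tangent.incl x v) (Tangent.incl x w)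
  conj_inner_symm v w := by
    simp only [mink, conj_trivial, real_inner_comm]
    ring
  re_inner_nonneg w := by simpa using neg_mink_nonneg x w
  add_left u v w := by
    simp only [mink, map_add, Prod.fst_add, Prod.snd_add, inner_add_left]
    ring
  smul_left v w c := by
    simp only [mink, map_smul, Prod.smul_fst, Prod.smul_snd, real_inner_smul_left, smul_eq_mul,
      conj_trivial]
    ring
  definite w hw := by
    have h1 := fst_sq_le x w
    have hw2 : -mink (Tangent.incl x w) (Tangent.incl x w) = 0 := hw
    rw [hw2, mul_zero] at h1
    have h2 : (Tangent.incl x w).1 = 0 := by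
      have := sq_nonneg (Tangent.incl x w).1
      exact pow_eq_zero_iff two_ne_zero |>.1 (le_antisymm h1 this)
    have h3 : (Tangent.incl x w).2 = 0 := by
      simp only [mink, h2] at hw2
      exact inner_self_eq_zero (𝕜 := ℝ).1 (by linarith)
    apply Tangent.incl_injective x
    rw [map_zero]
    exact Prod.ext h2 h3

instance {n : ℕ} (x : Hyp n) : NormedAddCommGroup (Tangent x) :=
  (tangentCore x).toNormedAddCommGroup

instance {n : ℕ} (x : Hyp n) : InnerProductSpace ℝ (Tangent x) :=
  InnerProductSpace.ofCore (tangentCore x).toCore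

theorem tangent_inner {n : ℕ} (x : Hyp n) (v w : Tangent x) :
    inner ℝ v w = -mink (Tangent.incl x v) (Tangent.incl x w) := rfl

theorem neg_mink_self {n : ℕ} (x : Hyp n) (w : Tangent x) :
    -mink (Tangent.incl x w) (Tangent.incl x w) = ‖w‖ ^ 2 := by
  rw [← tangent_inner, real_inner_self_eq_norm_sq]

/-- The tangent space is isometric to `ℝ^n`. -/
theorem exists_frame {n : ℕ} (x : Hyp n) :
    Nonempty (EuclideanSpace ℝ (Fin n) ≃ₗᵢ[ℝ] Tangent x) := by
  let f : Ambient n →ₗ[ℝ] ℝ :=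
    { toFun := fun w => mink x.1 w
      map_add' := by
        intro a b
        simp only [mink, Prod.fst_add, Prod.snd_add, inner_add_right]
        ring
      map_smul' := by
        intro c a
        simp only [mink, Prod.smul_fst, Prod.smul_snd, inner_smul_right, smul_eq_mul,
          RingHom.id_apply]
        ring }
  have hf : f ≠ 0 := by
    intro h
    have h1 : f x.1 = 1 := x.2.1
    rw [h] at h1
    simp at h1
  have hk : tangentSubmodule x = LinearMap.ker f := by
    ext w
    exact Iff.rfl
  have hd := Module.Dual.finrank_ker_add_one_of_ne_zero (f := f) hf
  have hamb : Module.finrank ℝ (Ambient n) = 1 + n := by simp [Ambient]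
  have hn : Module.finrank ℝ ↥(tangentSubmodule x) = n := by
    rw [hk]
    omega
  have : FiniteDimensional ℝ (Tangent x) :=
    inferInstanceAs (FiniteDimensional ℝ ↥(tangentSubmodule x))
  have hn2 : Module.finrank ℝ (Tangent x) = n := hn
  exact ⟨((stdOrthonormalBasis ℝ (Tangent x)).reindex (finCongr hn2)).repr.symm⟩

theorem exp_mem {n : ℕ} (x : Hyp n) (w : Tangent x) :
    mink (Real.cosh ‖w‖ • x.1 + (Real.sinh ‖w‖ / ‖w‖) • Tangent.incl x w)
      (Real.cosh ‖w‖ • x.1 + (Real.sinh ‖w‖ / ‖w‖) • Tangent.incl x w) = 1 ∧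
    0 < (Real.cosh ‖w‖ • x.1 + (Real.sinh ‖w‖ / ‖w‖) • Tangent.incl x w).1 := by
  rcases eq_or_ne w 0 with rfl | hw
  · simpa using x.2
  have ha : 0 < ‖w‖ := norm_pos_iff.2 hw
  have h1 := mink_incl x w
  have h2 := neg_mink_self x w
  have h3 := fst_sq_le x w
  have hx := x.2.1
  have hx0 := x.2.2
  rw [h2] at h3
  set a := ‖w‖
  set s := Real.sinh a / a with hs
  have hsa : s * a = Real.sinh a := by rw [hs]; field_simp
  have hcs := Real.cosh_sq a
  constructor
  · simp only [mink, Prod.fst_add, Prod.snd_add, Prod.smul_fst, Prod.smul_snd, inner_add_left,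
      inner_add_right, real_inner_smul_left, real_inner_smul_right, smul_eq_mul] at *
    rw [real_inner_comm x.1.2 (Tangent.incl x w).2]
    linear_combination Real.cosh a ^ 2 * hx + 2 * Real.cosh a * s * h1 - s ^ 2 * h2 + hcs
      - (s * a + Real.sinh a) * hsa
  · simp only [Prod.fst_add, Prod.smul_fst, smul_eq_mul]
    have hs0 : 0 < s := div_pos (Real.sinh_pos_iff.2 ha) ha
    have hb : |(Tangent.incl x w).1| ≤ x.1.1 * a := by
      apply abs_le_of_sq_le_sq _ (by positivity)
      nlinarith [sq_nonneg a]
    have hb2 := neg_le_of_abs_le hb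
    have hlt := Real.sinh_lt_cosh a
    have h4 : s * -(x.1.1 * a) ≤ s * (Tangent.incl x w).1 :=
      mul_le_mul_of_nonneg_left hb2 hs0.le
    have h5 : s * -(x.1.1 * a) = -(x.1.1 * Real.sinh a) := by rw [← hsa]; ring
    nlinarith

/-- The exponential map `exp_x w = cosh|w| x + sinh|w| w/|w|` of hyperbolic space. -/
def expMap {n : ℕ} (x : Hyp n) (w : Tangent x) : Hyp n :=
  ⟨Real.cosh ‖w‖ • x.1 + (Real.sinh ‖w‖ / ‖w‖) • Tangent.incl x w, exp_mem x w⟩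

/-- `t ↦ exp_x (t w)` is the geodesic issued from `x` with velocity `w`: its acceleration in the
ambient space is a multiple of the position, that is, normal to the hyperboloid. -/
theorem expMap_geodesic {n : ℕ} (x : Hyp n) (w : Tangent x) :
    (expMap x ((0 : ℝ) • w)).1 = x.1 ∧
    ∃ velocity : ℝ → Ambient n, velocity 0 = Tangent.incl x w ∧
      (∀ t : ℝ, HasDerivAt (fun s : ℝ => (expMap x (s • w)).1) (velocity t) t) ∧
      ∀ t : ℝ, HasDerivAt velocity (‖w‖ ^ 2 • (expMap x (t • w)).1) t := by
  refine ⟨by simp [expMap], ?_⟩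
  rcases eq_or_ne w 0 with rfl | hw
  · refine ⟨fun _ => 0, by simp, fun t => ?_, fun t => ?_⟩
    · simpa [expMap] using hasDerivAt_const t x.1
    · simpa using hasDerivAt_const t (0 : Ambient n)
  have ha : ‖w‖ ≠ 0 := norm_ne_zero_iff.2 hw
  have key : ∀ s : ℝ, (expMap x (s • w)).1 =
      Real.cosh (s * ‖w‖) • x.1 + (Real.sinh (s * ‖w‖) / ‖w‖) • Tangent.incl x w := by
    intro s
    simp only [expMap, norm_smul, Real.norm_eq_abs, map_smul, smul_smul]
    congr 2
    · rcases abs_cases s with h | h <;> rw [h.1]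
      rw [neg_mul, Real.cosh_neg]
    · rcases eq_or_ne s 0 with rfl | hs
      · simp
      rcases abs_cases s with h | h <;> rw [h.1]
      · field_simp
      · rw [neg_mul, Real.sinh_neg]
        field_simp
  have hlin : ∀ t : ℝ, HasDerivAt (fun s : ℝ => s * ‖w‖) ‖w‖ t := fun t => by
    simpa using (hasDerivAt_id t).mul_const ‖w‖
  refine ⟨fun t => (Real.sinh (t * ‖w‖) * ‖w‖) • x.1 + Real.cosh (t * ‖w‖) • Tangent.incl x w,
    by simp, fun t => ?_, fun t => ?_⟩
  · simp only [key]
    have h1 := ((hlin t).cosh).smul_const x.1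
    have h2 := (((hlin t).sinh).div_const ‖w‖).smul_const (Tangent.incl x w)
    rw [mul_div_assoc, div_self ha, mul_one] at h2
    exact h1.add h2
  · rw [key]
    have h1 := (((hlin t).sinh).mul_const ‖w‖).smul_const x.1
    have h2 := ((hlin t).cosh).smul_const (Tangent.incl x w)
    have h3 : ‖w‖ ^ 2 • (Real.cosh (t * ‖w‖) • x.1 +
          (Real.sinh (t * ‖w‖) / ‖w‖) • Tangent.incl x w) =
        (Real.cosh (t * ‖w‖) * ‖w‖ * ‖w‖) • x.1 +
          (Real.sinh (t * ‖w‖) * ‖w‖) • Tangent.incl x w := by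
      rw [smul_add, smul_smul, smul_smul]
      congr 2
      · ring
      · field_simp
    rw [h3]
    exact h1.add h2

/-- The area `ω_{d-1}` of the unit sphere `S^{d-1}` of `ℝ^d` (so `sphereArea 1 = ω₀ = 2`). -/
def sphereArea (d : ℕ) : ℝ :=
  (volume : Measure (EuclideanSpace ℝ (Fin d))).toSphere.real Set.univ

/-- `σ = (n - 1) / 2`. -/
def sigma (n : ℕ) : ℝ := ((n : ℝ) - 1) / 2

/-- The frequency `α ≥ 0` with `lam = σ² + α²` (for `lam ≥ σ²`). -/
def alpha (n : ℕ) (lam : ℝ) : ℝ := Real.sqrt (lam - sigma n ^ 2)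

/-- The spherical function
`F_{n,lam}(r) = ω_{n-2}/ω_{n-1} ∫₀^π (cosh r - sinh r cos θ)^{-σ + iα} (sin θ)^{n-2} dθ`. -/
def sphericalFn (n : ℕ) (lam r : ℝ) : ℂ :=
  ((sphereArea (n - 1) / sphereArea n : ℝ) : ℂ) *
    ∫ θ in (0 : ℝ)..Real.pi,
      ((Real.cosh r - Real.sinh r * Real.cos θ : ℝ) : ℂ) ^
          (-(sigma n : ℂ) + Complex.I * (alpha n lam : ℂ)) *
        ((Real.sin θ ^ (n - 2) : ℝ) : ℂ)

/-- `u` is (a version of) the hyperbolic random wave with eigenvalue `lam`: the Gaussian field on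
hyperbolic space with mean zero and covariance `F_{n,lam}(d(x,y))`. -/
structure IsHyperbolicRandomWave (n : ℕ) (lam : ℝ) {Ω : Type*} [MeasurableSpace Ω]
    (P : Measure Ω) (u : Hyp n → Ω → ℝ) : Prop where
  gaussian : IsGaussianProcess u P
  mean_zero : ∀ x, ∫ ω, u x ω ∂P = 0
  covariance : ∀ x y, ((∫ ω, u x ω * u y ω ∂P : ℝ) : ℂ) = sphericalFn n lam (hdist x y)

/-- The kernel `C^H_{n,lam}(v,v') = F_{n,lam}(d(exp_x (v/√lam), exp_x (v'/√lam)))`, the tangent space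
at `x` being identified with `ℝ^n` by a linear isometry `e`. -/
def localCov {n : ℕ} (x : Hyp n) (e : EuclideanSpace ℝ (Fin n) ≃ₗᵢ[ℝ] Tangent x) (lam : ℝ)
    (v w : EuclideanSpace ℝ (Fin n)) : ℂ :=
  sphericalFn n lam
    (hdist (expMap x (e ((Real.sqrt lam)⁻¹ • v))) (expMap x (e ((Real.sqrt lam)⁻¹ • w))))

/-- The covariance of the Euclidean random wave on `ℝ^n`,
`C_{n,lam}(v,v') = 1/ω_{n-1} ∫_{S^{n-1}} exp(i √lam ϑ·(v - v')) dϑ`. -/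
def berryCov (n : ℕ) (lam : ℝ) (v w : EuclideanSpace ℝ (Fin n)) : ℂ :=
  (((sphereArea n)⁻¹ : ℝ) : ℂ) *
    ∫ ϑ : Metric.sphere (0 : EuclideanSpace ℝ (Fin n)) 1,
      Complex.exp (Complex.I * ((Real.sqrt lam * inner ℝ (ϑ : EuclideanSpace ℝ (Fin n)) (v - w) : ℝ) : ℂ))
      ∂(volume : Measure (EuclideanSpace ℝ (Fin n))).toSphere

/-- The Bessel function of the first kind, for real `ν ≥ 0` and `z ≥ 0`. -/
def besselJ (ν z : ℝ) : ℝ :=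
  (z / 2) ^ ν * ∑' k : ℕ, (-z ^ 2 / 4) ^ k / ((k.factorial : ℝ) * Real.Gamma (ν + k + 1))

end HypWave

end

/-!
Write `n = m + 2`, and let `waveKernel m s = ω_m/ω_{m+1} ∫₀^π exp(-i s cos θ) (sin θ)^m dθ`.

**Berry's kernel.** Comparing moments (the sphere moments come from a Gaussian integral in polar
coordinates, the moments of `-cos θ` from a recurrence) shows that `berryCov n 1 v w` is
`waveKernel m ‖v - w‖` (`berryCov_one_eq_waveKernel`); the same power series is the Bessel kernel
(`berryCov_one_eq_besselJ`).

**The spherical function.** The substitution `exp (r t) = cosh r - sinh r cos θ` turns `F(r)` into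
`∫_{-1}^{1} exp(i α r t) hypWeight m r t dt`, whose phase is linear in `t`, while `t = -cos θ` turns
`waveKernel m s` into `∫_{-1}^{1} exp(i s t) flatWeight m t dt`. The two weights differ by a factor
`exp (O(r))` uniformly in `t`, so `F(r) - waveKernel m (α r) = O(exp (K r) - 1)`, uniformly in the
frequency (`exists_norm_sphericalFn_sub_waveKernel_le`). Removing the nonlinearity of the phase
before estimating is essential: `α r` is unbounded in the regime of the theorem, so an error of
relative size `r` in the phase would not be negligible.

**The distances.** For tangent vectors of length at most `ε`, the hyperbolic distance of their
exponentials is the Euclidean distance up to a factor `exp (O(ε))` (`hdist_expMap_mem_Icc`). With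
`ε = r_λ / √λ → 0` this says that `α d = κ ‖v - w‖` with `κ → 1` uniformly, although
`α d - ‖v - w‖` itself need not be small. Since `waveKernel m` is Lipschitz and vanishes at infinity
by the Riemann–Lebesgue lemma, `waveKernel m (κ s) - waveKernel m s` tends to `0` uniformly in
`s ≥ 0` as `κ → 1` (`exists_norm_waveKernel_dilate_sub_le`), which gives the limit.
-/

noncomputable section

namespace HypWave

/-! ### Even and odd moments of the sphere -/

/-- The radial part of a Gaussian moment. -/
theorem integral_Ioi_pow_mul_exp_neg_sq (k : ℕ) :
    ∫ t in Set.Ioi (0 : ℝ), t ^ k * Real.exp (-t ^ 2) = Real.Gamma (((k : ℝ) + 1) / 2) / 2 := by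
  have h := integral_rpow_mul_exp_neg_rpow (p := 2) (q := k) two_pos
    (by linarith [(Nat.cast_nonneg k : (0 : ℝ) ≤ k)])
  simp only [Real.rpow_natCast, Real.rpow_two] at h
  rw [h]
  ring

theorem integral_pow_two_mul_mul_exp_neg_sq (k : ℕ) :
    ∫ t : ℝ, t ^ (2 * k) * Real.exp (-t ^ 2) = Real.Gamma (k + 1 / 2) := by
  have h := integral_comp_abs (f := fun t : ℝ => t ^ (2 * k) * Real.exp (-t ^ 2))
  simp only [pow_mul, sq_abs] at h
  simp only [pow_mul]
  rw [h]
  simp only [← pow_mul]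
  rw [integral_Ioi_pow_mul_exp_neg_sq]
  push_cast
  ring_nf

section Sphere

variable {E : Type*} [NormedAddCommGroup E] [InnerProductSpace ℝ E] [FiniteDimensional ℝ E]
  [MeasurableSpace E] [BorelSpace E]

/-- A Gaussian moment in polar coordinates: the angular moment times a radial Gamma integral. -/
theorem integral_inner_pow_mul_exp_eq_toSphere [Nontrivial E] (j : ℕ) (u : E) :
    ∫ x : E, inner ℝ x u ^ j * Real.exp (-‖x‖ ^ 2) =
      (∫ ϑ : Metric.sphere (0 : E) 1, inner ℝ (ϑ : E) u ^ j ∂(volume : Measure E).toSphere) *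
        (Real.Gamma (((Module.finrank ℝ E : ℝ) + j) / 2) / 2) := by
  calc ∫ x : E, inner ℝ x u ^ j * Real.exp (-‖x‖ ^ 2)
      = ∫ x : ({(0)}ᶜ : Set E), inner ℝ (x : E) u ^ j * Real.exp (-‖(x : E)‖ ^ 2)
          ∂((volume : Measure E).comap (↑)) := by
        rw [integral_subtype_comap (measurableSet_singleton _).compl
          fun x : E => inner ℝ x u ^ j * Real.exp (-‖x‖ ^ 2), restrict_compl_singleton]
    _ = ∫ p, inner ℝ (p.1 : E) u ^ j * ((p.2 : ℝ) ^ j * Real.exp (-(p.2 : ℝ) ^ 2))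
          ∂(volume : Measure E).toSphere.prod (.volumeIoiPow (Module.finrank ℝ E - 1)) := by
        rw [← (volume : Measure E).measurePreserving_homeomorphUnitSphereProd.integral_comp
          (Homeomorph.measurableEmbedding _)]
        refine integral_congr_ae (ae_of_all _ fun x => ?_)
        have hx : ‖(x : E)‖ ≠ 0 := norm_ne_zero_iff.2 x.2
        simp only [homeomorphUnitSphereProd_apply_snd_coe, homeomorphUnitSphereProd_apply_fst_coe,
          real_inner_smul_left]
        rw [← mul_assoc, ← mul_pow]
        congr 2
        field_simp
    _ = (∫ ϑ : Metric.sphere (0 : E) 1, inner ℝ (ϑ : E) u ^ j ∂(volume : Measure E).toSphere) *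
          ∫ r : Set.Ioi (0 : ℝ), (r : ℝ) ^ j * Real.exp (-(r : ℝ) ^ 2)
            ∂.volumeIoiPow (Module.finrank ℝ E - 1) :=
        integral_prod_mul (L := ℝ) (fun ϑ : Metric.sphere (0 : E) 1 => inner ℝ (ϑ : E) u ^ j)
          (fun r : Set.Ioi (0 : ℝ) => (r : ℝ) ^ j * Real.exp (-(r : ℝ) ^ 2))
    _ = _ := by
        congr 1
        simp only [Measure.volumeIoiPow, ENNReal.ofReal]
        rw [integral_withDensity_eq_integral_smul
            (measurable_subtype_coe.pow_const _).real_toNNReal,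
          integral_subtype_comap measurableSet_Ioi fun a : ℝ =>
            Real.toNNReal (a ^ (Module.finrank ℝ E - 1)) • (a ^ j * Real.exp (-a ^ 2))]
        have h1 : ((Module.finrank ℝ E : ℝ) + j) / 2 =
            (((Module.finrank ℝ E - 1 + j : ℕ) : ℝ) + 1) / 2 := by
          rw [Nat.cast_add, Nat.cast_sub Module.finrank_pos]
          push_cast
          ring
        rw [h1, ← integral_Ioi_pow_mul_exp_neg_sq]
        refine setIntegral_congr_fun measurableSet_Ioi fun a ha => ?_
        simp only [NNReal.smul_def, Real.coe_toNNReal _ (pow_nonneg (le_of_lt ha) _), smul_eq_mul]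
        ring

/-- An even Gaussian moment in a unit direction, computed in an orthonormal basis containing
that direction. -/
theorem integral_inner_pow_two_mul_mul_exp {d : ℕ} (hd : Module.finrank ℝ E = d + 1) (k : ℕ)
    (u : E) (hu : ‖u‖ = 1) :
    ∫ x : E, inner ℝ x u ^ (2 * k) * Real.exp (-‖x‖ ^ 2) =
      Real.Gamma (k + 1 / 2) * √Real.pi ^ d := by
  have ho : Orthonormal ℝ (({0} : Set (Fin (d + 1))).domRestrict fun _ => u) := by
    rw [orthonormal_iff_ite]
    rintro ⟨i, hi⟩ ⟨j, hj⟩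
    obtain rfl : i = 0 := hi
    obtain rfl : j = 0 := hj
    simp [hu]
  obtain ⟨b, hb⟩ := ho.exists_orthonormalBasis_extension_of_card_eq (by simp [hd])
  have hb0 : b 0 = u := hb 0 rfl
  rw [← b.measurePreserving_repr_symm.integral_comp
    b.repr.symm.toHomeomorph.measurableEmbedding,
    ← (PiLp.volume_preserving_toLp (Fin (d + 1))).integral_comp
      (MeasurableEquiv.toLp 2 (Fin (d + 1) → ℝ)).measurableEmbedding]
  have key : ∀ y : Fin (d + 1) → ℝ,
      inner ℝ (b.repr.symm (WithLp.toLp 2 y)) u ^ (2 * k) *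
        Real.exp (-‖b.repr.symm (WithLp.toLp 2 y)‖ ^ 2) =
      ∏ i, (if i = 0 then fun t : ℝ => t ^ (2 * k) * Real.exp (-t ^ 2)
        else fun t : ℝ => Real.exp (-t ^ 2)) (y i) := by
    intro y
    have h1 : inner ℝ (b.repr.symm (WithLp.toLp 2 y)) u = y 0 := by
      rw [← hb0, real_inner_comm, ← b.repr_apply_apply]
      simp
    rw [h1, LinearIsometryEquiv.norm_map, EuclideanSpace.norm_sq_eq, Fin.prod_univ_succ,
      ← Finset.sum_neg_distrib, Real.exp_sum, Fin.prod_univ_succ]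
    simp [mul_assoc, Fin.succ_ne_zero]
  simp only [key]
  rw [integral_fintype_prod_volume_eq_prod, Fin.prod_univ_succ]
  have hg : ∫ t : ℝ, Real.exp (-t ^ 2) = √Real.pi := by
    simpa using integral_gaussian 1
  simp only [if_true, Fin.succ_ne_zero, if_false, hg, integral_pow_two_mul_mul_exp_neg_sq]
  simp

/-- Division of the Gaussian moment by its radial part. -/
theorem toSphere_integral_inner_pow_two_mul {d : ℕ} (hd : Module.finrank ℝ E = d + 1) (k : ℕ)
    (u : E) :
    ∫ ϑ : Metric.sphere (0 : E) 1, inner ℝ (ϑ : E) u ^ (2 * k) ∂(volume : Measure E).toSphere =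
      ‖u‖ ^ (2 * k) *
        (2 * Real.Gamma (k + 1 / 2) * √Real.pi ^ d / Real.Gamma (((d : ℝ) + 1) / 2 + k)) := by
  have : Nontrivial E := Module.nontrivial_of_finrank_pos (R := ℝ) (by omega)
  obtain ⟨w, hw, huw⟩ : ∃ w : E, ‖w‖ = 1 ∧ u = ‖u‖ • w := by
    rcases eq_or_ne u 0 with rfl | h0
    · obtain ⟨w, hw⟩ := exists_norm_eq (E := E) zero_le_one
      exact ⟨w, hw, by simp⟩
    · exact ⟨‖u‖⁻¹ • u, norm_smul_inv_norm h0, by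
        rw [smul_smul, mul_inv_cancel₀ (norm_ne_zero_iff.2 h0), one_smul]⟩
  have h := integral_inner_pow_mul_exp_eq_toSphere (2 * k) w
  rw [integral_inner_pow_two_mul_mul_exp hd k w hw, hd] at h
  have hG : ((d + 1 : ℕ) + (2 * k : ℕ) : ℝ) / 2 = ((d : ℝ) + 1) / 2 + k := by
    push_cast
    ring
  rw [hG] at h
  have hpos : Real.Gamma (((d : ℝ) + 1) / 2 + k) ≠ 0 := (Real.Gamma_pos_of_pos (by positivity)).ne'
  have hS : ∫ ϑ : Metric.sphere (0 : E) 1, inner ℝ (ϑ : E) w ^ (2 * k)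
      ∂(volume : Measure E).toSphere =
        2 * Real.Gamma (k + 1 / 2) * √Real.pi ^ d / Real.Gamma (((d : ℝ) + 1) / 2 + k) := by
    rw [eq_div_iff hpos]
    linarith
  rw [← hS, ← integral_const_mul]
  refine integral_congr_ae (ae_of_all _ fun ϑ => ?_)
  simp only
  rw [← mul_pow, ← real_inner_smul_right, ← huw]

theorem toSphere_integral_inner_pow_odd [Nontrivial E] (k : ℕ) (u : E) :
    ∫ ϑ : Metric.sphere (0 : E) 1, inner ℝ (ϑ : E) u ^ (2 * k + 1)
      ∂(volume : Measure E).toSphere = 0 := by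
  have h := integral_inner_pow_mul_exp_eq_toSphere (2 * k + 1) u
  have hG : 0 < Real.Gamma (((Module.finrank ℝ E : ℝ) + (2 * k + 1 : ℕ)) / 2) / 2 :=
    half_pos (Real.Gamma_pos_of_pos (by positivity))
  have h0 := integral_neg_eq_self
    (fun x : E => inner ℝ x u ^ (2 * k + 1) * Real.exp (-‖x‖ ^ 2)) volume
  have hodd : Odd (2 * k + 1) := ⟨k, rfl⟩
  simp only [inner_neg_left, hodd.neg_pow, norm_neg, neg_mul, integral_neg] at h0
  rw [h] at h0
  have h1 : (∫ ϑ : Metric.sphere (0 : E) 1, inner ℝ (ϑ : E) u ^ (2 * k + 1)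
      ∂(volume : Measure E).toSphere) *
        (Real.Gamma (((Module.finrank ℝ E : ℝ) + (2 * k + 1 : ℕ)) / 2) / 2) = 0 := by linarith
  exact (mul_eq_zero.1 h1).resolve_right hG.ne'

end Sphere

theorem sphereArea_succ (d : ℕ) :
    sphereArea (d + 1) = 2 * √Real.pi ^ (d + 1) / Real.Gamma (((d : ℝ) + 1) / 2) := by
  have h := toSphere_integral_inner_pow_two_mul
    (E := EuclideanSpace ℝ (Fin (d + 1))) (d := d) (by simp) 0 0
  have hG : Real.Gamma (1 / 2) = √Real.pi := Real.Gamma_one_half_eq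
  simp only [mul_zero, pow_zero, integral_const, smul_eq_mul, mul_one, Nat.cast_zero, zero_add,
    add_zero, one_mul, hG] at h
  rw [sphereArea, h, pow_succ]
  ring

theorem sphereArea_succ_pos (d : ℕ) : 0 < sphereArea (d + 1) := by
  rw [sphereArea_succ]
  have := Real.Gamma_pos_of_pos (s := ((d : ℝ) + 1) / 2) (by positivity)
  have := Real.pi_pos
  positivity

/-! ### Moments of the polar angle -/

/-- The `j`-th moment of `-cos θ` on `[0, π]` with weight `(sin θ)^m`. The sign matches the
substitution `t = -cos θ`, which increases from `-1` to `1`. -/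
def polarMoment (m j : ℕ) : ℝ := ∫ θ in (0 : ℝ)..Real.pi, (-Real.cos θ) ^ j * Real.sin θ ^ m

/-- Integration of the derivative of `(-cos θ)^j (sin θ)^(m+1)`, which vanishes at both ends.
For `j = 0` the truncated index `j - 1` is harmless, its coefficient being `0`. -/
theorem polarMoment_succ_mul (m j : ℕ) :
    polarMoment m (j + 1) * (m + 1 + j) = j * polarMoment m (j - 1) := by
  have hint : ∀ i : ℕ, IntervalIntegrable (fun θ => (-Real.cos θ) ^ i * Real.sin θ ^ m) volume
      0 Real.pi := fun i => Continuous.intervalIntegrable (by fun_prop) _ _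
  have hder : ∀ θ ∈ Set.uIcc 0 Real.pi,
      HasDerivAt (fun θ => (-Real.cos θ) ^ j * Real.sin θ ^ (m + 1))
        (j * ((-Real.cos θ) ^ (j - 1) * Real.sin θ ^ m) -
          (m + 1 + j) * ((-Real.cos θ) ^ (j + 1) * Real.sin θ ^ m)) θ := by
    intro θ _
    have h := ((Real.hasDerivAt_cos θ).neg.pow j).mul ((Real.hasDerivAt_sin θ).pow (m + 1))
    refine h.congr_deriv ?_
    have hs : Real.sin θ ^ (m + 1) * Real.sin θ = (1 - Real.cos θ ^ 2) * Real.sin θ ^ m := by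
      rw [← Real.sin_sq]
      ring
    rcases j with _ | j
    · simp
      ring
    · simp
      linear_combination ((j : ℝ) + 1) * (-Real.cos θ) ^ j * hs
  have h := intervalIntegral.integral_eq_sub_of_hasDerivAt hder
    (((hint _).const_mul _).sub ((hint _).const_mul _))
  rw [intervalIntegral.integral_sub ((hint _).const_mul _) ((hint _).const_mul _),
    intervalIntegral.integral_const_mul, intervalIntegral.integral_const_mul] at h
  simp only [Real.sin_pi, Real.sin_zero, zero_pow (Nat.succ_ne_zero m), mul_zero, sub_zero] at h
  rw [polarMoment, polarMoment]
  linarith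

theorem polarMoment_odd (m k : ℕ) : polarMoment m (2 * k + 1) = 0 := by
  induction k with
  | zero =>
    have h := polarMoment_succ_mul m 0
    simp only [Nat.cast_zero, zero_mul] at h
    exact (mul_eq_zero.1 h).resolve_right (by positivity)
  | succ k ih =>
    have h := polarMoment_succ_mul m (2 * k + 2)
    rw [show 2 * k + 2 - 1 = 2 * k + 1 by omega, ih, mul_zero] at h
    exact (mul_eq_zero.1 h).resolve_right (by positivity)

theorem polarMoment_zero (m : ℕ) :
    polarMoment m 0 = √Real.pi * Real.Gamma (((m : ℝ) + 1) / 2) / Real.Gamma ((m : ℝ) / 2 + 1) := by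
  induction m using Nat.twoStepInduction with
  | zero =>
    have hG : Real.Gamma 2⁻¹ = √Real.pi := by rw [← one_div, Real.Gamma_one_half_eq]
    simp [polarMoment, hG, Real.mul_self_sqrt Real.pi_pos.le]
  | one =>
    have h : Real.Gamma (1 / 2 + 1) = 1 / 2 * √Real.pi := by
      rw [Real.Gamma_add_one (by norm_num), Real.Gamma_one_half_eq]
    have hpi : √Real.pi ≠ 0 := (Real.sqrt_pos.2 Real.pi_pos).ne'
    simp only [polarMoment, pow_zero, one_mul, pow_one, integral_sin, Real.cos_zero, Real.cos_pi,
      Nat.cast_one, h]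
    norm_num
    field_simp
  | more m ih _ =>
    have h := integral_sin_pow (a := 0) (b := Real.pi) m
    simp only [Real.sin_pi, Real.sin_zero, zero_pow (Nat.succ_ne_zero m), zero_mul, sub_zero,
      zero_div, zero_add] at h
    simp only [polarMoment, pow_zero, one_mul] at ih ⊢
    rw [h, ih]
    push_cast
    have h1 : Real.Gamma (((m : ℝ) + 2 + 1) / 2) =
        ((m : ℝ) + 1) / 2 * Real.Gamma (((m : ℝ) + 1) / 2) := by
      rw [← Real.Gamma_add_one (by positivity)]
      ring_nf
    have h2 : Real.Gamma (((m : ℝ) + 2) / 2 + 1) =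
        ((m : ℝ) / 2 + 1) * Real.Gamma ((m : ℝ) / 2 + 1) := by
      rw [← Real.Gamma_add_one (by positivity)]
      ring_nf
    have h3 : Real.Gamma ((m : ℝ) / 2 + 1) ≠ 0 := (Real.Gamma_pos_of_pos (by positivity)).ne'
    rw [h1, h2]
    generalize Real.Gamma ((m : ℝ) / 2 + 1) = A at h3 ⊢
    generalize Real.Gamma (((m : ℝ) + 1) / 2) = B
    field_simp

theorem polarMoment_two_mul (m k : ℕ) :
    polarMoment m (2 * k) =
      Real.Gamma (k + 1 / 2) * Real.Gamma (((m : ℝ) + 1) / 2) / Real.Gamma ((m : ℝ) / 2 + 1 + k) := by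
  induction k with
  | zero =>
    rw [mul_zero, polarMoment_zero, ← Real.Gamma_one_half_eq]
    simp
  | succ k ih =>
    have h := polarMoment_succ_mul m (2 * k + 1)
    rw [show 2 * k + 1 - 1 = 2 * k by omega, show 2 * k + 1 + 1 = 2 * (k + 1) by ring, ih] at h
    push_cast at h ⊢
    have hG : Real.Gamma ((m : ℝ) / 2 + 1 + k) ≠ 0 := (Real.Gamma_pos_of_pos (by positivity)).ne'
    rw [show (k : ℝ) + 1 + 1 / 2 = (k + 1 / 2) + 1 by ring,
      show (m : ℝ) / 2 + 1 + (k + 1) = ((m : ℝ) / 2 + 1 + k) + 1 by ring,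
      Real.Gamma_add_one (by positivity), Real.Gamma_add_one (s := (m : ℝ) / 2 + 1 + k) (by positivity)]
    have h2 : (m : ℝ) + 1 + (2 * k + 1) ≠ 0 := by positivity
    rw [← eq_div_iff h2] at h
    rw [h]
    field_simp
    ring

/-- Slicing the sphere by hyperplanes orthogonal to `u`, at the level of moments. -/
theorem toSphere_moment_eq_polarMoment (m j : ℕ) (u : EuclideanSpace ℝ (Fin (m + 2))) :
    ∫ ϑ : Metric.sphere (0 : EuclideanSpace ℝ (Fin (m + 2))) 1,
        inner ℝ (ϑ : EuclideanSpace ℝ (Fin (m + 2))) u ^ j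
          ∂(volume : Measure (EuclideanSpace ℝ (Fin (m + 2)))).toSphere =
      ‖u‖ ^ j * (sphereArea (m + 1) * polarMoment m j) := by
  rcases Nat.even_or_odd' j with ⟨k, rfl | rfl⟩
  · rw [toSphere_integral_inner_pow_two_mul (d := m + 1) (by simp), polarMoment_two_mul,
      sphereArea_succ]
    have hG : Real.Gamma (((m : ℝ) + 1) / 2) ≠ 0 := (Real.Gamma_pos_of_pos (by positivity)).ne'
    rw [show (((m + 1 : ℕ) : ℝ) + 1) / 2 + k = (m : ℝ) / 2 + 1 + k by push_cast; ring]
    field_simp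
  · rw [toSphere_integral_inner_pow_odd, polarMoment_odd, mul_zero, mul_zero]

/-! ### Berry's covariance as a polar integral and as a Bessel kernel -/

/-- Term-by-term integration of the exponential series of a bounded phase. -/
theorem hasSum_integral_cexp_mul {X : Type*} [MeasurableSpace X] {μ : Measure X} {f g : X → ℝ}
    (hf : AEStronglyMeasurable f μ) (hg : Integrable g μ) {B : ℝ} (hB : ∀ x, |f x| ≤ B) :
    HasSum (fun j : ℕ => Complex.I ^ j / (j.factorial : ℂ) * ((∫ x, f x ^ j * g x ∂μ : ℝ) : ℂ))
      (∫ x, Complex.exp (Complex.I * (f x : ℂ)) * (g x : ℂ) ∂μ) := by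
  have hF : ∀ j : ℕ, Complex.I ^ j / (j.factorial : ℂ) * ((∫ x, f x ^ j * g x ∂μ : ℝ) : ℂ) =
      ∫ x, (Complex.I * (f x : ℂ)) ^ j / (j.factorial : ℂ) * (g x : ℂ) ∂μ := by
    intro j
    rw [← integral_complex_ofReal, ← integral_const_mul]
    refine integral_congr_ae (ae_of_all _ fun x => ?_)
    push_cast
    ring
  simp only [hF]
  have hsum : ∀ x, Summable fun j : ℕ => B ^ j / (j.factorial : ℝ) * |g x| := fun x =>
    (Real.summable_pow_div_factorial B).mul_right _
  refine hasSum_integral_of_dominated_convergence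
    (fun j x => B ^ j / (j.factorial : ℝ) * |g x|) (fun j => ?_)
    (fun j => ae_of_all _ fun x => ?_) (ae_of_all _ hsum) ?_ (ae_of_all _ fun x => ?_)
  · have h1 := Complex.continuous_ofReal.comp_aestronglyMeasurable hf
    have h2 := Complex.continuous_ofReal.comp_aestronglyMeasurable hg.aestronglyMeasurable
    have h3 := ((h1.const_mul Complex.I).pow j).mul_const ((j.factorial : ℂ)⁻¹)
    exact h3.mul h2
  · simp only [norm_mul, norm_div, norm_pow, Complex.norm_I, one_mul, Complex.norm_real,
      Real.norm_eq_abs, Complex.norm_natCast]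
    gcongr
    exact hB x
  · simp only [tsum_mul_right]
    exact hg.abs.const_mul _
  · have h := NormedSpace.expSeries_div_hasSum_exp (Complex.I * (f x : ℂ))
    rw [← Complex.exp_eq_exp_ℂ] at h
    exact h.mul_right _

/-- The radial profile of Berry's covariance of frequency `1` on `ℝ^(m+2)`, written as an
integral over the polar angle:
`ω_m/ω_{m+1} ∫₀^π exp(-i s cos θ) (sin θ)^m dθ`. -/
def waveKernel (m : ℕ) (s : ℝ) : ℂ :=
  ((sphereArea (m + 1) / sphereArea (m + 2) : ℝ) : ℂ) *
    ∫ θ in (0 : ℝ)..Real.pi,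
      Complex.exp (Complex.I * ((s * -Real.cos θ : ℝ) : ℂ)) * ((Real.sin θ ^ m : ℝ) : ℂ)

theorem hasSum_berryCov_one (m : ℕ) (v w : EuclideanSpace ℝ (Fin (m + 2))) :
    HasSum (fun j : ℕ => (((sphereArea (m + 2))⁻¹ : ℝ) : ℂ) * (Complex.I ^ j / (j.factorial : ℂ) *
      ((‖v - w‖ ^ j * (sphereArea (m + 1) * polarMoment m j) : ℝ) : ℂ)))
      (berryCov (m + 2) 1 v w) := by
  have h := hasSum_integral_cexp_mul
    (μ := (volume : Measure (EuclideanSpace ℝ (Fin (m + 2)))).toSphere)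
    (f := fun ϑ : Metric.sphere (0 : EuclideanSpace ℝ (Fin (m + 2))) 1 =>
      inner ℝ (ϑ : EuclideanSpace ℝ (Fin (m + 2))) (v - w)) (g := fun _ => 1)
    (Continuous.aestronglyMeasurable (by fun_prop)) (integrable_const _) (B := ‖v - w‖)
    (fun ϑ => by simpa using abs_real_inner_le_norm (ϑ : EuclideanSpace ℝ (Fin (m + 2))) (v - w))
  simp only [mul_one, toSphere_moment_eq_polarMoment, Complex.ofReal_one] at h
  simp only [berryCov, Real.sqrt_one, one_mul]
  exact h.mul_left _

theorem berryCov_one_eq_waveKernel (m : ℕ) (v w : EuclideanSpace ℝ (Fin (m + 2))) :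
    berryCov (m + 2) 1 v w = waveKernel m ‖v - w‖ := by
  refine (hasSum_berryCov_one m v w).unique ?_
  have h := hasSum_integral_cexp_mul (μ := volume.restrict (Set.Ioc 0 Real.pi))
    (f := fun θ => ‖v - w‖ * -Real.cos θ) (g := fun θ => Real.sin θ ^ m)
    (Continuous.aestronglyMeasurable (by fun_prop))
    (Continuous.intervalIntegrable (μ := volume) (by fun_prop) 0 Real.pi).1 (B := ‖v - w‖)
    (fun θ => by
      rw [abs_mul, abs_neg, abs_norm]
      exact mul_le_of_le_one_right (norm_nonneg _) (Real.abs_cos_le_one θ))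
  have h2 := h.mul_left ((sphereArea (m + 1) / sphereArea (m + 2) : ℝ) : ℂ)
  rw [← intervalIntegral.integral_of_le Real.pi_pos.le] at h2
  refine h2.congr_fun fun j => ?_
  have hj : ∫ θ in Set.Ioc 0 Real.pi, (‖v - w‖ * -Real.cos θ) ^ j * Real.sin θ ^ m =
      ‖v - w‖ ^ j * polarMoment m j := by
    rw [polarMoment, intervalIntegral.integral_of_le Real.pi_pos.le, ← integral_const_mul]
    simp only [mul_pow, mul_assoc]
  rw [hj]
  push_cast
  ring

theorem Gamma_nat_add_half_mul (k : ℕ) :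
    Real.Gamma (k + 1 / 2) * (4 ^ k * k.factorial) = (2 * k).factorial * √Real.pi := by
  induction k with
  | zero => simp [Real.Gamma_one_half_eq, -one_div]
  | succ k ih =>
    rw [show 2 * (k + 1) = 2 * k + 1 + 1 by ring, Nat.factorial_succ, Nat.factorial_succ,
      Nat.factorial_succ]
    push_cast
    rw [show (k : ℝ) + 1 + 1 / 2 = (k + 1 / 2) + 1 by ring, Real.Gamma_add_one (by positivity)]
    linear_combination (2 * (k : ℝ) + 1) * (2 * (k : ℝ) + 1 + 1) * ih

theorem berryCov_one_eq_besselJ (m : ℕ) (v w : EuclideanSpace ℝ (Fin (m + 2))) (hvw : v ≠ w) :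
    berryCov (m + 2) 1 v w =
      (((2 * Real.pi) ^ (((m + 2 : ℕ) : ℝ) / 2) / sphereArea (m + 2) *
        ‖v - w‖ ^ (1 - ((m + 2 : ℕ) : ℝ) / 2) *
          besselJ (((m + 2 : ℕ) : ℝ) / 2 - 1) ‖v - w‖ : ℝ) : ℂ) := by
  have hs : 0 < ‖v - w‖ := norm_pos_iff.2 (sub_ne_zero.2 hvw)
  set s := ‖v - w‖
  have h := hasSum_berryCov_one m v w
  -- only the even moments contribute
  have hinj : Function.Injective fun k : ℕ => 2 * k := fun a b hab => by simpa using hab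
  rw [← hinj.hasSum_iff] at h
  swap
  · intro j hj
    rcases Nat.even_or_odd' j with ⟨k, rfl | rfl⟩
    · exact absurd ⟨k, rfl⟩ hj
    · simp [polarMoment_odd]
  have hterm : ∀ k : ℕ, (((sphereArea (m + 2))⁻¹ : ℝ) : ℂ) *
      (Complex.I ^ (2 * k) / ((2 * k).factorial : ℂ) *
        ((s ^ (2 * k) * (sphereArea (m + 1) * polarMoment m (2 * k)) : ℝ) : ℂ)) =
      ((2 * √Real.pi ^ (m + 2) / sphereArea (m + 2) * ((-s ^ 2 / 4) ^ k /
        ((k.factorial : ℝ) * Real.Gamma (((m + 2 : ℕ) : ℝ) / 2 - 1 + k + 1))) : ℝ) : ℂ) := by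
    intro k
    have hI : Complex.I ^ (2 * k) = (((-1 : ℝ) ^ k : ℝ) : ℂ) := by
      rw [pow_mul, Complex.I_sq]
      push_cast
      rfl
    have hG := Gamma_nat_add_half_mul k
    have hk : Real.Gamma (k + 1 / 2) = (2 * k).factorial * √Real.pi / (4 ^ k * k.factorial) := by
      rw [eq_div_iff (by positivity), hG]
    have hreal : (sphereArea (m + 2))⁻¹ * ((-1) ^ k / ((2 * k).factorial : ℝ) *
        (s ^ (2 * k) * (sphereArea (m + 1) * polarMoment m (2 * k)))) =
        2 * √Real.pi ^ (m + 2) / sphereArea (m + 2) * ((-s ^ 2 / 4) ^ k /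
          ((k.factorial : ℝ) * Real.Gamma (((m + 2 : ℕ) : ℝ) / 2 - 1 + k + 1))) := by
      have hA : Real.Gamma (((m : ℝ) + 1) / 2) ≠ 0 := (Real.Gamma_pos_of_pos (by positivity)).ne'
      have hB : Real.Gamma ((m : ℝ) / 2 + 1 + k) ≠ 0 :=
        (Real.Gamma_pos_of_pos (by positivity)).ne'
      have hf : ((2 * k).factorial : ℝ) ≠ 0 := by positivity
      have hf2 : (k.factorial : ℝ) ≠ 0 := by positivity
      have hω := (sphereArea_succ_pos (m + 1)).ne'
      rw [polarMoment_two_mul, sphereArea_succ m, hk,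
        show ((m + 2 : ℕ) : ℝ) / 2 - 1 + k + 1 = (m : ℝ) / 2 + 1 + k by push_cast; ring,
        show (-s ^ 2 / 4) ^ k = (-1) ^ k * s ^ (2 * k) / 4 ^ k by
          rw [div_pow, neg_pow, pow_mul]]
      generalize Real.Gamma (((m : ℝ) + 1) / 2) = A at hA ⊢
      generalize Real.Gamma ((m : ℝ) / 2 + 1 + k) = B at hB ⊢
      generalize sphereArea (m + 2) = W at hω ⊢
      field_simp
      ring
    rw [hI, ← hreal]
    push_cast
    ring
  have h2 := (h.congr_fun fun k => (hterm k).symm).tsum_eq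
  rw [← Complex.ofReal_tsum, tsum_mul_left] at h2
  rw [← h2, besselJ]
  congr 1
  generalize ∑' k : ℕ, (-s ^ 2 / 4) ^ k /
    ((k.factorial : ℝ) * Real.Gamma (((m + 2 : ℕ) : ℝ) / 2 - 1 + k + 1)) = S
  set ν : ℝ := ((m + 2 : ℕ) : ℝ) / 2 - 1 with hν
  have hn : ((m + 2 : ℕ) : ℝ) / 2 = ν + 1 := by rw [hν]; ring
  have hpi : √Real.pi ^ (m + 2) = Real.pi ^ (ν + 1) := by
    rw [← hn, Real.sqrt_eq_rpow, ← Real.rpow_natCast, ← Real.rpow_mul Real.pi_pos.le]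
    ring_nf
  have h2ν : (2 : ℝ) ^ (ν + 1) = 2 * 2 ^ ν := by
    rw [Real.rpow_add_one two_ne_zero]
    ring
  have hsν : s ^ (-ν) * s ^ ν = 1 := by rw [← Real.rpow_add hs]; simp
  have h2p : (2 : ℝ) ^ ν ≠ 0 := (Real.rpow_pos_of_pos two_pos _).ne'
  have hω := (sphereArea_succ_pos (m + 1)).ne'
  rw [hn, show 1 - (ν + 1) = -ν by ring, Real.mul_rpow two_pos.le Real.pi_pos.le, hpi, h2ν,
    Real.div_rpow hs.le two_pos.le]
  field_simp
  linear_combination (-S) * hsν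

/-! ### Linearizing the phase of the spherical function -/

/-- `sin θ` as a function of `t = -cos θ`. -/
def flatSin (t : ℝ) : ℝ := √(1 - t ^ 2)

/-- The density `(1 - t²)^((m-1)/2)` on `(-1, 1)`, the image of `(sin θ)^m dθ` under
`t = -cos θ`. -/
def flatWeight (m : ℕ) (t : ℝ) : ℝ := flatSin t ^ m / flatSin t

/-- `sin θ` as a function of the `t ∈ (-1, 1)` with `exp (r t) = cosh r - sinh r cos θ`. -/
def hypSin (r t : ℝ) : ℝ := √(2 * Real.exp (r * t) * (Real.cosh r - Real.cosh (r * t))) / Real.sinh r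

/-- The image of the amplitude of the spherical function on `ℍ^(m+2)` under the substitution
`exp (r t) = cosh r - sinh r cos θ`. -/
def hypWeight (m : ℕ) (r t : ℝ) : ℝ :=
  Real.exp ((1 - sigma (m + 2)) * (r * t)) * (r / Real.sinh r) * (hypSin r t ^ m / hypSin r t)

theorem neg_cos_image_Ioo : (fun θ => -Real.cos θ) '' Set.Ioo 0 Real.pi = Set.Ioo (-1) 1 := by
  ext t
  constructor
  · rintro ⟨θ, ⟨h0, hπ⟩, rfl⟩
    have h1 := Real.cos_lt_cos_of_nonneg_of_le_pi le_rfl hπ.le h0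
    have h2 := Real.cos_lt_cos_of_nonneg_of_le_pi h0.le le_rfl hπ
    rw [Real.cos_zero] at h1
    rw [Real.cos_pi] at h2
    constructor <;> simp only <;> linarith
  · rintro ⟨h1, h2⟩
    refine ⟨Real.arccos (-t), ⟨Real.arccos_pos.2 (by linarith), ?_⟩, ?_⟩
    · rw [Real.arccos_neg]
      linarith [Real.arccos_pos.2 h2]
    · simp only
      rw [Real.cos_arccos (by linarith) (by linarith), neg_neg]

theorem injOn_neg_cos : Set.InjOn (fun θ => -Real.cos θ) (Set.Ioo 0 Real.pi) :=
  fun _ ha _ hb hab => Real.injOn_cos ⟨ha.1.le, ha.2.le⟩ ⟨hb.1.le, hb.2.le⟩ (neg_injective hab)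

theorem flatSin_neg_cos {θ : ℝ} (hθ : θ ∈ Set.Ioo 0 Real.pi) :
    flatSin (-Real.cos θ) = Real.sin θ := by
  rw [flatSin, neg_sq, ← Real.sin_sq, Real.sqrt_sq (Real.sin_pos_of_mem_Ioo hθ).le]

theorem hasDerivWithinAt_neg_cos (θ : ℝ) (s : Set ℝ) :
    HasDerivWithinAt (fun θ => -Real.cos θ) (Real.sin θ) s θ :=
  ((Real.hasDerivAt_cos θ).fun_neg.congr_deriv (neg_neg _)).hasDerivWithinAt

theorem flatWeight_nonneg (m : ℕ) (t : ℝ) : 0 ≤ flatWeight m t :=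
  div_nonneg (pow_nonneg (Real.sqrt_nonneg _) _) (Real.sqrt_nonneg _)

theorem integrableOn_flatWeight (m : ℕ) : IntegrableOn (flatWeight m) (Set.Ioo (-1) 1) := by
  rw [← neg_cos_image_Ioo, integrableOn_image_iff_integrableOn_abs_deriv_smul measurableSet_Ioo
    (fun θ _ => hasDerivWithinAt_neg_cos θ _) injOn_neg_cos]
  have h : IntegrableOn (fun θ => Real.sin θ ^ m) (Set.Ioo 0 Real.pi) :=
    ((Continuous.intervalIntegrable (by fun_prop) 0 Real.pi).1).mono_set Set.Ioo_subset_Ioc_self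
  refine h.congr_fun (fun θ hθ => ?_) measurableSet_Ioo
  have hs := Real.sin_pos_of_mem_Ioo hθ
  simp only [flatWeight, flatSin_neg_cos hθ, abs_of_pos hs, smul_eq_mul]
  field_simp

theorem waveKernel_eq_integral_flatWeight (m : ℕ) (s : ℝ) :
    waveKernel m s = ((sphereArea (m + 1) / sphereArea (m + 2) : ℝ) : ℂ) *
      ∫ t in Set.Ioo (-1) 1, Complex.exp (Complex.I * ((s * t : ℝ) : ℂ)) *
        (flatWeight m t : ℂ) := by
  rw [← neg_cos_image_Ioo, integral_image_eq_integral_abs_deriv_smul measurableSet_Ioo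
    (fun θ _ => hasDerivWithinAt_neg_cos θ _) injOn_neg_cos, waveKernel,
    intervalIntegral.integral_of_le Real.pi_pos.le, integral_Ioc_eq_integral_Ioo]
  congr 1
  refine setIntegral_congr_fun measurableSet_Ioo fun θ hθ => ?_
  have hs := Real.sin_pos_of_mem_Ioo hθ
  have hs' : (Real.sin θ : ℂ) ≠ 0 := Complex.ofReal_ne_zero.2 hs.ne'
  simp only [flatWeight, flatSin_neg_cos hθ, abs_of_pos hs, Complex.real_smul]
  push_cast at hs' ⊢
  field_simp

theorem cosh_sub_sinh_mul_cos_pos (r θ : ℝ) : 0 < Real.cosh r - Real.sinh r * Real.cos θ := by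
  have h1 : |Real.sinh r| < Real.cosh r := by
    rw [Real.abs_sinh, ← Real.cosh_abs r]
    exact Real.sinh_lt_cosh _
  have h2 : Real.sinh r * Real.cos θ ≤ |Real.sinh r| := by
    refine (le_abs_self _).trans ?_
    rw [abs_mul]
    exact mul_le_of_le_one_right (abs_nonneg _) (Real.abs_cos_le_one θ)
  linarith

theorem log_phase_image_Ioo {r : ℝ} (hr : 0 < r) :
    (fun θ => Real.log (Real.cosh r - Real.sinh r * Real.cos θ) / r) '' Set.Ioo 0 Real.pi =
      Set.Ioo (-1) 1 := by
  have hS := Real.sinh_pos_iff.2 hr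
  have he1 := Real.cosh_add_sinh r
  have he2 := Real.cosh_sub_sinh r
  ext t
  constructor
  · rintro ⟨θ, hθ, rfl⟩
    have h := neg_cos_image_Ioo.subset ⟨θ, hθ, rfl⟩
    have hq := cosh_sub_sinh_mul_cos_pos r θ
    have h1 : -r < Real.log (Real.cosh r - Real.sinh r * Real.cos θ) := by
      rw [Real.lt_log_iff_exp_lt hq]
      nlinarith [h.1, h.2]
    have h2 : Real.log (Real.cosh r - Real.sinh r * Real.cos θ) < r := by
      rw [Real.log_lt_iff_lt_exp hq]
      nlinarith [h.1, h.2]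
    constructor
    · rw [lt_div_iff₀ hr]
      linarith
    · rw [div_lt_iff₀ hr]
      linarith
  · rintro ⟨h1, h2⟩
    have h3 : Real.exp (r * t) < Real.exp r := Real.exp_lt_exp.2 (by nlinarith)
    have h4 : Real.exp (-r) < Real.exp (r * t) := Real.exp_lt_exp.2 (by nlinarith)
    have h5 : -((Real.cosh r - Real.exp (r * t)) / Real.sinh r) ∈ Set.Ioo (-1 : ℝ) 1 := by
      constructor
      · rw [neg_lt_neg_iff, div_lt_one hS]
        linarith
      · rw [neg_lt, lt_div_iff₀ hS]
        linarith
    rw [← neg_cos_image_Ioo] at h5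
    obtain ⟨θ, hθ, hc⟩ := h5
    refine ⟨θ, hθ, ?_⟩
    have hc' : Real.cos θ = (Real.cosh r - Real.exp (r * t)) / Real.sinh r := neg_injective hc
    simp only
    rw [hc', mul_div_cancel₀ _ hS.ne', sub_sub_cancel, Real.log_exp, mul_div_cancel_left₀ _ hr.ne']

theorem injOn_log_phase {r : ℝ} (hr : 0 < r) :
    Set.InjOn (fun θ => Real.log (Real.cosh r - Real.sinh r * Real.cos θ) / r)
      (Set.Ioo 0 Real.pi) := by
  intro a ha b hb hab
  refine injOn_neg_cos ha hb ?_
  have h1 := Real.log_injOn_pos (cosh_sub_sinh_mul_cos_pos r a) (cosh_sub_sinh_mul_cos_pos r b)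
    ((div_left_inj' hr.ne').1 hab)
  have h2 : Real.sinh r * Real.cos a = Real.sinh r * Real.cos b := by linarith
  simpa using mul_left_cancel₀ (Real.sinh_pos_iff.2 hr).ne' h2

theorem hasDerivWithinAt_log_phase (r θ : ℝ) (s : Set ℝ) :
    HasDerivWithinAt (fun θ => Real.log (Real.cosh r - Real.sinh r * Real.cos θ) / r)
      (Real.sinh r * Real.sin θ / (Real.cosh r - Real.sinh r * Real.cos θ) / r) s θ := by
  have h := ((((Real.hasDerivAt_cos θ).const_mul (Real.sinh r)).const_sub (Real.cosh r)).log
    (cosh_sub_sinh_mul_cos_pos r θ).ne').div_const r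
  refine (h.congr_deriv ?_).hasDerivWithinAt
  ring

theorem hypSin_log_phase {r θ : ℝ} (hr : 0 < r) (hθ : θ ∈ Set.Ioo 0 Real.pi) :
    hypSin r (Real.log (Real.cosh r - Real.sinh r * Real.cos θ) / r) = Real.sin θ := by
  have hS := Real.sinh_pos_iff.2 hr
  have hs := Real.sin_pos_of_mem_Ioo hθ
  have hq := cosh_sub_sinh_mul_cos_pos r θ
  rw [hypSin, mul_div_cancel₀ _ hr.ne', Real.exp_log hq, Real.cosh_log hq]
  have h : 2 * (Real.cosh r - Real.sinh r * Real.cos θ) * (Real.cosh r -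
      ((Real.cosh r - Real.sinh r * Real.cos θ) + (Real.cosh r - Real.sinh r * Real.cos θ)⁻¹) / 2) =
      (Real.sinh r * Real.sin θ) ^ 2 := by
    field_simp
    linear_combination Real.cosh_sq r - Real.sinh r ^ 2 * Real.sin_sq_add_cos_sq θ
  rw [h, Real.sqrt_sq (by positivity), mul_div_cancel_left₀ _ hS.ne']

/-- In the variable `t`, the phase of the spherical function is exactly `α r t`. -/
theorem sphericalFn_eq_integral_hypWeight (m : ℕ) (lam : ℝ) {r : ℝ} (hr : 0 < r) :
    sphericalFn (m + 2) lam r = ((sphereArea (m + 1) / sphereArea (m + 2) : ℝ) : ℂ) *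
      ∫ t in Set.Ioo (-1) 1,
        Complex.exp (Complex.I * ((alpha (m + 2) lam * r * t : ℝ) : ℂ)) *
          (hypWeight m r t : ℂ) := by
  rw [← log_phase_image_Ioo hr, integral_image_eq_integral_abs_deriv_smul measurableSet_Ioo
    (fun θ _ => hasDerivWithinAt_log_phase r θ _) (injOn_log_phase hr), sphericalFn,
    intervalIntegral.integral_of_le Real.pi_pos.le, integral_Ioc_eq_integral_Ioo]
  congr 1
  refine setIntegral_congr_fun measurableSet_Ioo fun θ hθ => ?_
  have hs := Real.sin_pos_of_mem_Ioo hθ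
  have hS := Real.sinh_pos_iff.2 hr
  have hq := cosh_sub_sinh_mul_cos_pos r θ
  simp only [hypWeight, hypSin_log_phase hr hθ, Complex.real_smul]
  rw [mul_div_cancel₀ _ hr.ne', abs_of_pos (by positivity),
    Complex.cpow_def_of_ne_zero (Complex.ofReal_ne_zero.2 hq.ne'), ← Complex.ofReal_log hq.le]
  have hexp : Real.exp ((1 - sigma (m + 2)) *
      Real.log (Real.cosh r - Real.sinh r * Real.cos θ)) =
      (Real.cosh r - Real.sinh r * Real.cos θ) *
        Real.exp (-sigma (m + 2) * Real.log (Real.cosh r - Real.sinh r * Real.cos θ)) := by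
    rw [one_sub_mul, sub_eq_add_neg, Real.exp_add, Real.exp_log hq, neg_mul]
  rw [hexp]
  generalize Real.cosh r - Real.sinh r * Real.cos θ = q at hq ⊢
  have h1 : (Real.log q : ℂ) * (-(sigma (m + 2) : ℂ) + Complex.I * (alpha (m + 2) lam : ℂ)) =
      Complex.I * ((alpha (m + 2) lam * r * (Real.log q / r) : ℝ) : ℂ) +
        ((-sigma (m + 2) * Real.log q : ℝ) : ℂ) := by
    rw [show alpha (m + 2) lam * r * (Real.log q / r) = alpha (m + 2) lam * Real.log q by
      field_simp]
    push_cast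
    ring
  rw [h1, Complex.exp_add, ← Complex.ofReal_exp, show m + 2 - 2 = m by omega]
  have key : (Real.exp (-sigma (m + 2) * Real.log q) : ℂ) * ((Real.sin θ ^ m : ℝ) : ℂ) =
      ((Real.sinh r * Real.sin θ / q / r : ℝ) : ℂ) *
        ((q * Real.exp (-sigma (m + 2) * Real.log q) * (r / Real.sinh r) *
          (Real.sin θ ^ m / Real.sin θ) : ℝ) : ℂ) := by
    rw [← Complex.ofReal_mul, ← Complex.ofReal_mul]
    congr 1
    field_simp
  linear_combination Complex.exp (Complex.I *
    ((alpha (m + 2) lam * r * (Real.log q / r) : ℝ) : ℂ)) * key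

/-! ### Comparison of the spherical function with the Euclidean kernel -/

theorem sinh_le_mul_exp (x : ℝ) : Real.sinh x ≤ x * Real.exp x := by
  have h := mul_le_mul_of_nonneg_left (Real.add_one_le_exp (-2 * x)) (Real.exp_pos x).le
  rw [← Real.exp_add, show x + -2 * x = -x by ring] at h
  rw [Real.sinh_eq]
  linarith

theorem log_sinh_mem_Icc {x : ℝ} (hx : 0 < x) :
    Real.log (Real.sinh x) ∈ Set.Icc (Real.log x) (Real.log x + x) := by
  have h1 := Real.self_le_sinh_iff.2 hx.le
  refine ⟨Real.log_le_log hx h1, ?_⟩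
  have h2 := Real.log_le_log (Real.sinh_pos_iff.2 hx) (sinh_le_mul_exp x)
  rwa [Real.log_mul hx.ne' (Real.exp_pos x).ne', Real.log_exp] at h2

/-- In half-angle form, `1 - t² = 4ab/r²` and `cosh r - cosh (r t) = 2 sinh a sinh b` with
`a = r(1+t)/2`, `b = r(1-t)/2`, so the two sines agree up to a factor `exp (O(r))`, uniformly up to
the end points `t = ±1`. -/
theorem abs_log_hypSin_sub_le {r t : ℝ} (hr : 0 < r) (ht : t ∈ Set.Ioo (-1 : ℝ) 1) :
    0 < flatSin t ∧ 0 < hypSin r t ∧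
      |Real.log (hypSin r t) - Real.log (flatSin t)| ≤ 2 * r := by
  obtain ⟨ht1, ht2⟩ := ht
  have ha : 0 < r * (1 + t) / 2 := by
    have : 0 < 1 + t := by linarith
    positivity
  have hb : 0 < r * (1 - t) / 2 := by
    have : 0 < 1 - t := by linarith
    positivity
  set a := r * (1 + t) / 2 with hadef
  set b := r * (1 - t) / 2 with hbdef
  have hab : a + b = r := by rw [hadef, hbdef]; ring
  have hab' : a - b = r * t := by rw [hadef, hbdef]; ring
  have hSr := Real.sinh_pos_iff.2 hr
  have hSa := Real.sinh_pos_iff.2 ha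
  have hSb := Real.sinh_pos_iff.2 hb
  have hE := Real.exp_pos (r * t)
  have hflat : flatSin t = 2 * √(a * b) / r := by
    rw [flatSin, show 1 - t ^ 2 = (2 / r) ^ 2 * (a * b) by rw [hadef, hbdef]; field_simp; ring,
      Real.sqrt_mul (by positivity), Real.sqrt_sq (by positivity)]
    ring
  have hhyp : hypSin r t =
      2 * √(Real.exp (r * t) * (Real.sinh a * Real.sinh b)) / Real.sinh r := by
    have hc : Real.cosh r - Real.cosh (r * t) = 2 * (Real.sinh a * Real.sinh b) := by
      rw [← hab', ← hab, Real.cosh_add, Real.cosh_sub]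
      ring
    rw [hypSin, hc, show 2 * Real.exp (r * t) * (2 * (Real.sinh a * Real.sinh b)) =
      2 ^ 2 * (Real.exp (r * t) * (Real.sinh a * Real.sinh b)) by ring,
      Real.sqrt_mul (by positivity), Real.sqrt_sq (by positivity)]
  refine ⟨by rw [hflat]; positivity, by rw [hhyp]; positivity, ?_⟩
  rw [hflat, hhyp, Real.log_div (by positivity) hr.ne', Real.log_div (by positivity) hSr.ne',
    Real.log_mul two_ne_zero (by positivity), Real.log_mul two_ne_zero (by positivity),
    Real.log_sqrt (by positivity), Real.log_sqrt (by positivity), Real.log_mul hE.ne'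
    (by positivity), Real.log_exp, Real.log_mul ha.ne' hb.ne', Real.log_mul hSa.ne' hSb.ne']
  obtain ⟨h1, h2⟩ := log_sinh_mem_Icc ha
  obtain ⟨h3, h4⟩ := log_sinh_mem_Icc hb
  obtain ⟨h5, h6⟩ := log_sinh_mem_Icc hr
  have h7 : r * t ≤ r := by nlinarith
  have h8 : -r ≤ r * t := by nlinarith
  rw [abs_le]
  constructor <;> linarith

theorem abs_hypWeight_sub_le (m : ℕ) {r t : ℝ} (hr : 0 < r) (ht : t ∈ Set.Ioo (-1 : ℝ) 1) :
    |hypWeight m r t - flatWeight m t| ≤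
      (Real.exp ((3 * m + 4) * r) - 1) * flatWeight m t := by
  obtain ⟨hf, hh, hlog⟩ := abs_log_hypSin_sub_le hr ht
  have hSr := Real.sinh_pos_iff.2 hr
  have hflat : 0 < flatWeight m t := by unfold flatWeight; positivity
  have hhyp : 0 < hypWeight m r t := by unfold hypWeight; positivity
  set L := Real.log (hypWeight m r t) - Real.log (flatWeight m t) with hL
  have hLeq : L = (1 - sigma (m + 2)) * (r * t) + (Real.log r - Real.log (Real.sinh r)) +
      ((m : ℝ) - 1) * (Real.log (hypSin r t) - Real.log (flatSin t)) := by
    rw [hL, hypWeight, flatWeight, Real.log_mul (by positivity) (by positivity),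
      Real.log_mul (by positivity) (by positivity), Real.log_exp, Real.log_div hr.ne' hSr.ne',
      Real.log_div (by positivity) hh.ne', Real.log_div (by positivity) hf.ne', Real.log_pow,
      Real.log_pow]
    ring
  have hm : (0 : ℝ) ≤ m := Nat.cast_nonneg m
  have hLabs : |L| ≤ (3 * m + 4) * r := by
    obtain ⟨h5, h6⟩ := log_sinh_mem_Icc hr
    have h1 : |(1 - sigma (m + 2)) * (r * t)| ≤ (m + 1) * r := by
      rw [abs_mul, abs_mul, abs_of_pos hr]
      have e1 : |1 - sigma (m + 2)| ≤ m + 1 := by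
        rw [sigma, abs_le]
        push_cast
        constructor <;> linarith
      have e2 : |t| ≤ 1 := abs_le.2 ⟨ht.1.le, ht.2.le⟩
      exact mul_le_mul e1 (mul_le_of_le_one_right hr.le e2) (by positivity) (by positivity)
    have h2 : |Real.log r - Real.log (Real.sinh r)| ≤ r := by
      rw [abs_le]
      constructor <;> linarith
    have h3 : |((m : ℝ) - 1) * (Real.log (hypSin r t) - Real.log (flatSin t))| ≤
        (m + 1) * (2 * r) := by
      rw [abs_mul]
      have e1 : |(m : ℝ) - 1| ≤ m + 1 := by
        rw [abs_le]
        constructor <;> linarith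
      exact mul_le_mul e1 hlog (abs_nonneg _) (by positivity)
    rw [hLeq]
    refine (abs_add_three _ _ _).trans ?_
    linarith
  -- the two weights differ by the factor `exp L`
  have hexp : hypWeight m r t = Real.exp L * flatWeight m t := by
    rw [hL, Real.exp_sub, Real.exp_log hhyp, Real.exp_log hflat, div_mul_cancel₀ _ hflat.ne']
  have hE : |Real.exp L - 1| ≤ Real.exp ((3 * m + 4) * r) - 1 := by
    obtain ⟨h1, h2⟩ := abs_le.1 hLabs
    have h3 := Real.exp_le_exp.2 h2
    have h4 := Real.exp_le_exp.2 h1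
    have h5 : 2 ≤ Real.exp (-((3 * m + 4) * r)) + Real.exp ((3 * m + 4) * r) := by
      have := Real.one_le_cosh ((3 * m + 4) * r)
      rw [Real.cosh_eq] at this
      linarith
    rw [abs_le]
    constructor <;> linarith
  rw [hexp, ← sub_one_mul, abs_mul, abs_of_pos hflat]
  exact mul_le_mul_of_nonneg_right hE hflat.le

theorem measurable_hypWeight (m : ℕ) (r : ℝ) : Measurable (hypWeight m r) := by
  unfold hypWeight hypSin
  fun_prop

theorem measurable_flatWeight (m : ℕ) : Measurable (flatWeight m) := by
  unfold flatWeight flatSin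
  fun_prop

theorem integrableOn_hypWeight_sub (m : ℕ) {r : ℝ} (hr : 0 < r) :
    IntegrableOn (fun t => hypWeight m r t - flatWeight m t) (Set.Ioo (-1) 1) := by
  refine Integrable.mono' ((integrableOn_flatWeight m).const_mul (Real.exp ((3 * m + 4) * r) - 1))
    ((measurable_hypWeight m r).sub (measurable_flatWeight m)).aestronglyMeasurable ?_
  filter_upwards [ae_restrict_mem measurableSet_Ioo] with t ht
  exact abs_hypWeight_sub_le m hr ht

theorem waveKernel_zero_eq_sphericalFn_zero (m : ℕ) (lam : ℝ) :
    sphericalFn (m + 2) lam 0 = waveKernel m 0 := by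
  simp [sphericalFn, waveKernel]

/-- The spherical function is close to the Euclidean kernel at scaled distance `α r` as soon as `r`
is small, uniformly in the frequency. -/
theorem exists_norm_sphericalFn_sub_waveKernel_le (m : ℕ) :
    ∃ C : ℝ, 0 ≤ C ∧ ∀ lam r : ℝ, 0 ≤ r →
      ‖sphericalFn (m + 2) lam r - waveKernel m (alpha (m + 2) lam * r)‖ ≤
        C * (Real.exp ((3 * m + 4) * r) - 1) := by
  refine ⟨sphereArea (m + 1) / sphereArea (m + 2) * ∫ t in Set.Ioo (-1) 1, flatWeight m t,
    mul_nonneg (div_nonneg (sphereArea_succ_pos m).le (sphereArea_succ_pos (m + 1)).le)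
      (integral_nonneg fun t => flatWeight_nonneg m t), fun lam r hr => ?_⟩
  rcases hr.eq_or_lt with rfl | hr
  · rw [mul_zero, waveKernel_zero_eq_sphericalFn_zero]
    simp
  set c := sphereArea (m + 1) / sphereArea (m + 2)
  have hc : 0 ≤ c := div_nonneg (sphereArea_succ_pos m).le (sphereArea_succ_pos (m + 1)).le
  have hnorm : ∀ t : ℝ,
      ‖Complex.exp (Complex.I * ((alpha (m + 2) lam * r * t : ℝ) : ℂ))‖ = 1 := fun t => by
    rw [mul_comm, Complex.norm_exp_ofReal_mul_I]
  have hmeas : Measurable fun t : ℝ =>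
      Complex.exp (Complex.I * ((alpha (m + 2) lam * r * t : ℝ) : ℂ)) := by fun_prop
  have hflat := integrableOn_flatWeight m
  have hhyp : IntegrableOn (hypWeight m r) (Set.Ioo (-1) 1) :=
    ((integrableOn_hypWeight_sub m hr).add hflat).congr_fun (fun t _ => by simp) measurableSet_Ioo
  have hint : ∀ g : ℝ → ℝ, IntegrableOn g (Set.Ioo (-1) 1) → IntegrableOn (fun t =>
      Complex.exp (Complex.I * ((alpha (m + 2) lam * r * t : ℝ) : ℂ)) * (g t : ℂ))
        (Set.Ioo (-1) 1) := fun g hg =>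
    (hg.ofReal (𝕜 := ℂ)).bdd_mul hmeas.aestronglyMeasurable (ae_of_all _ fun t => (hnorm t).le)
  rw [sphericalFn_eq_integral_hypWeight m lam hr, waveKernel_eq_integral_flatWeight, ← mul_sub,
    ← integral_sub (hint _ hhyp) (hint _ hflat), norm_mul, Complex.norm_real, Real.norm_of_nonneg hc,
    mul_assoc]
  refine mul_le_mul_of_nonneg_left ?_ hc
  rw [mul_comm (∫ t in Set.Ioo (-1) 1, flatWeight m t), ← integral_const_mul]
  refine norm_integral_le_of_norm_le (hflat.const_mul _) ?_
  filter_upwards [ae_restrict_mem measurableSet_Ioo] with t ht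
  rw [← mul_sub, norm_mul, hnorm, one_mul, ← Complex.ofReal_sub, Complex.norm_real]
  exact abs_hypWeight_sub_le m hr ht

/-- `waveKernel m` is Lipschitz. -/
theorem exists_norm_waveKernel_sub_le (m : ℕ) :
    ∃ C : ℝ, 0 ≤ C ∧ ∀ s s' : ℝ, ‖waveKernel m s - waveKernel m s'‖ ≤ C * |s - s'| := by
  have hc : 0 ≤ sphereArea (m + 1) / sphereArea (m + 2) :=
    div_nonneg (sphereArea_succ_pos m).le (sphereArea_succ_pos (m + 1)).le
  refine ⟨sphereArea (m + 1) / sphereArea (m + 2) * Real.pi, mul_nonneg hc Real.pi_pos.le,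
    fun s s' => ?_⟩
  rw [waveKernel, waveKernel, ← mul_sub, ← intervalIntegral.integral_sub
    (Continuous.intervalIntegrable (by fun_prop) _ _)
    (Continuous.intervalIntegrable (by fun_prop) _ _), norm_mul, Complex.norm_real,
    Real.norm_of_nonneg hc, mul_assoc]
  refine mul_le_mul_of_nonneg_left ?_ hc
  have hb : ∀ θ ∈ Set.uIoc 0 Real.pi,
      ‖Complex.exp (Complex.I * ((s * -Real.cos θ : ℝ) : ℂ)) * ((Real.sin θ ^ m : ℝ) : ℂ) -
        Complex.exp (Complex.I * ((s' * -Real.cos θ : ℝ) : ℂ)) * ((Real.sin θ ^ m : ℝ) : ℂ)‖ ≤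
      |s - s'| := by
    intro θ _
    have h1 : Complex.exp (Complex.I * ((s * -Real.cos θ : ℝ) : ℂ)) =
        Complex.exp (Complex.I * ((s' * -Real.cos θ : ℝ) : ℂ)) *
          Complex.exp (Complex.I * (((s - s') * -Real.cos θ : ℝ) : ℂ)) := by
      rw [← Complex.exp_add]
      congr 1
      push_cast
      ring
    rw [h1, ← sub_mul, ← mul_sub_one, norm_mul, norm_mul, mul_comm Complex.I,
      Complex.norm_exp_ofReal_mul_I, one_mul, Complex.norm_real, norm_pow, Real.norm_eq_abs]
    have h2 := Real.norm_exp_I_mul_ofReal_sub_one_le (x := (s - s') * -Real.cos θ)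
    rw [norm_mul, norm_neg, Real.norm_eq_abs, Real.norm_eq_abs] at h2
    have h3 : |s - s'| * |Real.cos θ| ≤ |s - s'| :=
      mul_le_of_le_one_right (abs_nonneg _) (Real.abs_cos_le_one θ)
    exact mul_le_of_le_one_right (norm_nonneg _)
      (pow_le_one₀ (abs_nonneg _) (Real.abs_sin_le_one θ)) |>.trans (h2.trans h3)
  have h := intervalIntegral.norm_integral_le_of_norm_le_const hb
  rwa [sub_zero, abs_of_pos Real.pi_pos, mul_comm] at h

/-- The Riemann–Lebesgue lemma for the weight `(1 - t²)^((m-1)/2)`. -/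
theorem tendsto_waveKernel_atTop (m : ℕ) : Tendsto (waveKernel m) atTop (𝓝 0) := by
  have h := Real.tendsto_integral_exp_smul_cocompact
    ((Set.Ioo (-1 : ℝ) 1).indicator fun t => (flatWeight m t : ℂ))
  have hlin : Tendsto (fun s : ℝ => -(2 * Real.pi)⁻¹ * s) atTop (cocompact ℝ) :=
    (tendsto_id.const_mul_atTop_of_neg (by simp [Real.pi_pos])).mono_right atBot_le_cocompact
  have h2 := (h.comp hlin).const_mul ((sphereArea (m + 1) / sphereArea (m + 2) : ℝ) : ℂ)
  rw [mul_zero] at h2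
  refine h2.congr fun s => ?_
  rw [waveKernel_eq_integral_flatWeight, ← integral_indicator measurableSet_Ioo]
  congr 1
  refine integral_congr_ae (ae_of_all _ fun t => ?_)
  by_cases ht : t ∈ Set.Ioo (-1 : ℝ) 1
  · simp only [Set.indicator_of_mem ht, Circle.smul_def, Real.fourierChar_apply, smul_eq_mul]
    congr 2
    push_cast
    field_simp
  · simp [Set.indicator_of_notMem ht]

/-- A Lipschitz function vanishing at infinity hardly changes, uniformly on the half-line, under
dilations close to the identity. -/
theorem exists_norm_waveKernel_dilate_sub_le (m : ℕ) {ε : ℝ} (hε : 0 < ε) :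
    ∃ δ > 0, ∀ κ : ℝ, |κ - 1| ≤ δ → ∀ s : ℝ, 0 ≤ s →
      ‖waveKernel m (κ * s) - waveKernel m s‖ ≤ ε := by
  obtain ⟨C, hC, hlip⟩ := exists_norm_waveKernel_sub_le m
  have hev := (tendsto_waveKernel_atTop m).norm.eventually_le_const
    (by simpa using half_pos hε : ‖(0 : ℂ)‖ < ε / 2)
  obtain ⟨M, hM⟩ := eventually_atTop.1 hev
  set N := max M 1
  have hN : 1 ≤ N := le_max_right _ _
  -- below `2 N` the Lipschitz bound applies; beyond, both `s` and `κ s` exceed `M` as `κ ≥ 1/2`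
  refine ⟨min (1 / 2) (ε / (2 * N * (C + 1))), by positivity, fun κ hκ s hs => ?_⟩
  have hκ1 : |κ - 1| ≤ 1 / 2 := hκ.trans (min_le_left _ _)
  have hκ2 : |κ - 1| ≤ ε / (2 * N * (C + 1)) := hκ.trans (min_le_right _ _)
  rcases le_total s (2 * N) with hsN | hsN
  · refine (hlip _ _).trans ?_
    rw [← sub_one_mul, abs_mul, abs_of_nonneg hs]
    calc C * (|κ - 1| * s) ≤ (C + 1) * (ε / (2 * N * (C + 1)) * (2 * N)) := by gcongr; linarith
      _ = ε := by field_simp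
  · have h1 := (abs_le.1 hκ1).1
    have hs2 : M ≤ s := (le_max_left M 1).trans (by linarith)
    have hs3 : M ≤ κ * s := (le_max_left M 1).trans (by nlinarith)
    calc _ ≤ ‖waveKernel m (κ * s)‖ + ‖waveKernel m s‖ := norm_sub_le _ _
      _ ≤ ε := by linarith [hM _ hs2, hM _ hs3]

/-! ### Geodesic distance and the scaling limit -/

theorem two_mul_cosh_sub_one (y : ℝ) : 2 * (Real.cosh y - 1) = (2 * Real.sinh (y / 2)) ^ 2 := by
  have h := Real.cosh_two_mul (y / 2)
  rw [mul_div_cancel₀ _ two_ne_zero, Real.cosh_sq] at h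
  rw [h]
  ring

theorem sq_le_two_mul_cosh_sub_one (y : ℝ) : y ^ 2 ≤ 2 * (Real.cosh y - 1) := by
  rw [← Real.cosh_abs, ← sq_abs y, two_mul_cosh_sub_one]
  have h := Real.self_le_sinh_iff.2 (by positivity : 0 ≤ |y| / 2)
  exact pow_le_pow_left₀ (abs_nonneg y) (by linarith) 2

theorem two_mul_cosh_sub_one_le (y : ℝ) : 2 * (Real.cosh y - 1) ≤ Real.exp |y| * y ^ 2 := by
  rw [← Real.cosh_abs, ← sq_abs y, two_mul_cosh_sub_one]
  have h0 := Real.sinh_nonneg_iff.2 (by positivity : 0 ≤ |y| / 2)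
  have h := sinh_le_mul_exp (|y| / 2)
  calc (2 * Real.sinh (|y| / 2)) ^ 2 ≤ (|y| * Real.exp (|y| / 2)) ^ 2 :=
        pow_le_pow_left₀ (by positivity) (by linarith) 2
    _ = Real.exp |y| * |y| ^ 2 := by
        rw [mul_pow, ← Real.exp_nat_mul, mul_comm]
        congr 2
        push_cast
        ring

/-- The hyperbolic law of cosines. -/
theorem mink_expMap {n : ℕ} (x : Hyp n) (p q : Tangent x) :
    mink (expMap x p).1 (expMap x q).1 = Real.cosh ‖p‖ * Real.cosh ‖q‖ -
      Real.sinh ‖p‖ / ‖p‖ * (Real.sinh ‖q‖ / ‖q‖) * inner ℝ p q := by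
  have h1 := mink_incl x p
  have h2 := mink_incl x q
  have hx := x.2.1
  simp only [expMap, tangent_inner]
  simp only [mink, Prod.fst_add, Prod.snd_add, Prod.smul_fst, Prod.smul_snd, inner_add_left,
    inner_add_right, real_inner_smul_left, real_inner_smul_right, smul_eq_mul] at *
  rw [real_inner_comm x.1.2 (Tangent.incl x p).2]
  generalize Real.sinh ‖p‖ / ‖p‖ = sp
  generalize Real.sinh ‖q‖ / ‖q‖ = sq
  linear_combination Real.cosh ‖p‖ * Real.cosh ‖q‖ * hx + Real.cosh ‖q‖ * sp * h1 +
    Real.cosh ‖p‖ * sq * h2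

/-- The angular term of the law of cosines compared with its Euclidean counterpart. -/
theorem angular_term_mem_Icc {n : ℕ} (x : Hyp n) (p q : Tangent x) {ε : ℝ} (hp : ‖p‖ ≤ ε)
    (hq : ‖q‖ ≤ ε) :
    Real.sinh ‖p‖ * Real.sinh ‖q‖ - Real.sinh ‖p‖ / ‖p‖ * (Real.sinh ‖q‖ / ‖q‖) * inner ℝ p q ∈
      Set.Icc (‖p‖ * ‖q‖ - inner ℝ p q) (Real.exp (2 * ε) * (‖p‖ * ‖q‖ - inner ℝ p q)) := by
  -- at a zero vector the junk value `sinh 0 / 0 = 0` is multiplied by a vanishing inner product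
  rcases eq_or_ne p 0 with rfl | hp0
  · simp
  rcases eq_or_ne q 0 with rfl | hq0
  · simp
  have hP : 0 < ‖p‖ := norm_pos_iff.2 hp0
  have hQ : 0 < ‖q‖ := norm_pos_iff.2 hq0
  have hk : 0 ≤ ‖p‖ * ‖q‖ - inner ℝ p q := sub_nonneg.2 (real_inner_le_norm p q)
  have heq : Real.sinh ‖p‖ * Real.sinh ‖q‖ -
      Real.sinh ‖p‖ / ‖p‖ * (Real.sinh ‖q‖ / ‖q‖) * inner ℝ p q =
      Real.sinh ‖p‖ / ‖p‖ * (Real.sinh ‖q‖ / ‖q‖) * (‖p‖ * ‖q‖ - inner ℝ p q) := by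
    field_simp
  have hbound : ∀ y : ℝ, 0 < y → y ≤ ε →
      1 ≤ Real.sinh y / y ∧ Real.sinh y / y ≤ Real.exp ε := fun y hy hyε =>
    ⟨(one_le_div hy).2 (Real.self_le_sinh_iff.2 hy.le), (div_le_iff₀' hy).2
      ((sinh_le_mul_exp y).trans (mul_le_mul_of_nonneg_left (Real.exp_le_exp.2 hyε) hy.le))⟩
  obtain ⟨hp1, hp2⟩ := hbound _ hP hp
  obtain ⟨hq1, hq2⟩ := hbound _ hQ hq
  rw [heq, two_mul, Real.exp_add]
  exact ⟨le_mul_of_one_le_left hk (one_le_mul_of_one_le_of_one_le hp1 hq1),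
    mul_le_mul_of_nonneg_right (mul_le_mul hp2 hq2 (by linarith) (Real.exp_pos _).le) hk⟩

/-- Near the origin of the tangent space, the exponential map is bi-Lipschitz with constants tending
to `1`. -/
theorem hdist_expMap_mem_Icc {n : ℕ} (x : Hyp n) (p q : Tangent x) {ε : ℝ} (hε : ε ≤ 1)
    (hp : ‖p‖ ≤ ε) (hq : ‖q‖ ≤ ε) :
    hdist (expMap x p) (expMap x q) ∈
      Set.Icc (Real.exp (-3 * ε) * ‖p - q‖) (Real.exp ε * ‖p - q‖) := by
  have hε0 : 0 ≤ ε := (norm_nonneg p).trans hp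
  set c := mink (expMap x p).1 (expMap x q).1 with hc
  obtain ⟨hk1, hk2⟩ := angular_term_mem_Icc x p q hp hq
  set k := Real.sinh ‖p‖ * Real.sinh ‖q‖ -
    Real.sinh ‖p‖ / ‖p‖ * (Real.sinh ‖q‖ / ‖q‖) * inner ℝ p q with hkdef
  have hck : c = Real.cosh (‖p‖ - ‖q‖) + k := by
    rw [hc, mink_expMap, Real.cosh_sub, hkdef]
    ring
  -- the Euclidean law of cosines in the same form: a radial and an angular term
  have hD : ‖p - q‖ ^ 2 = (‖p‖ - ‖q‖) ^ 2 + 2 * (‖p‖ * ‖q‖ - inner ℝ p q) := by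
    rw [norm_sub_sq_real]
    ring
  have hPQ : |‖p‖ - ‖q‖| ≤ 2 * ε := by
    rw [abs_le]
    constructor <;> linarith [norm_nonneg p, norm_nonneg q]
  have hlow : ‖p - q‖ ^ 2 ≤ 2 * (c - 1) := by
    rw [hD, hck]
    linarith [sq_le_two_mul_cosh_sub_one (‖p‖ - ‖q‖)]
  have hup : 2 * (c - 1) ≤ Real.exp (2 * ε) * ‖p - q‖ ^ 2 := by
    rw [hD, hck, mul_add]
    have h1 := two_mul_cosh_sub_one_le (‖p‖ - ‖q‖)
    have h2 := mul_le_mul_of_nonneg_right (Real.exp_le_exp.2 hPQ) (sq_nonneg (‖p‖ - ‖q‖))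
    linarith
  have hc1 : 1 ≤ c := by nlinarith [sq_nonneg ‖p - q‖]
  have hdc : hdist (expMap x p) (expMap x q) = Real.arcosh c := rfl
  have hcosh := Real.cosh_arcosh hc1
  have hd0 := Real.arcosh_nonneg hc1
  rw [hdc]
  generalize Real.arcosh c = d at hcosh hd0 ⊢
  rw [← hcosh, two_mul_cosh_sub_one] at hlow hup
  have hS0 := Real.sinh_nonneg_iff.2 (by positivity : 0 ≤ d / 2)
  have hS1 := Real.self_le_sinh_iff.2 (by positivity : 0 ≤ d / 2)
  have hS2 := sinh_le_mul_exp (d / 2)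
  have hl : ‖p - q‖ ≤ 2 * Real.sinh (d / 2) := le_of_sq_le_sq hlow (by positivity)
  have hu : 2 * Real.sinh (d / 2) ≤ Real.exp ε * ‖p - q‖ := by
    refine le_of_sq_le_sq (hup.trans_eq ?_) (by positivity)
    rw [mul_pow, ← Real.exp_nat_mul]
    push_cast
    rfl
  have hd1 : d ≤ Real.exp ε * ‖p - q‖ := by linarith
  refine ⟨?_, hd1⟩
  have hDε : ‖p - q‖ ≤ 2 * ε := (norm_sub_le p q).trans (by linarith)
  have hexp3 : Real.exp ε ≤ 3 :=
    (Real.exp_le_exp.2 hε).trans (by linarith [Real.exp_one_lt_d9])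
  have hd6 : d ≤ 6 * ε := hd1.trans ((mul_le_mul hexp3 hDε (norm_nonneg _) (by norm_num)).trans_eq
    (by ring))
  have hfin : ‖p - q‖ ≤ d * Real.exp (3 * ε) := by
    refine hl.trans ?_
    have := mul_le_mul_of_nonneg_left (Real.exp_le_exp.2 (by linarith : d / 2 ≤ 3 * ε)) hd0
    linarith
  calc Real.exp (-3 * ε) * ‖p - q‖ ≤ Real.exp (-3 * ε) * (d * Real.exp (3 * ε)) := by gcongr
    _ = d := by
      rw [mul_left_comm, ← Real.exp_add]
      simp

theorem tendsto_alpha_div_sqrt (n : ℕ) :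
    Tendsto (fun lam => alpha n lam / √lam) atTop (𝓝 1) := by
  have h1 : Tendsto (fun lam : ℝ => √(1 - sigma n ^ 2 / lam)) atTop (𝓝 √(1 - 0)) :=
    (tendsto_const_nhds.sub (tendsto_const_nhds.div_atTop tendsto_id)).sqrt
  rw [sub_zero, Real.sqrt_one] at h1
  refine h1.congr' ?_
  filter_upwards [eventually_gt_atTop 0] with lam hlam
  rw [alpha, ← Real.sqrt_div' _ hlam.le, sub_div, div_self hlam.ne']

/-- The uniform estimate behind the limit: replace the spherical function by `waveKernel` at the
scaled distance `α d`, then undo the dilation `κ = α d / ‖v - w‖`. -/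
theorem eventually_norm_localCov_sub_berryCov_le (m : ℕ) (x : Hyp (m + 2))
    (e : EuclideanSpace ℝ (Fin (m + 2)) ≃ₗᵢ[ℝ] Tangent x) {r : ℝ → ℝ} (hr : r =o[atTop] Real.sqrt)
    {η : ℝ} (hη : 0 < η) :
    ∀ᶠ lam in atTop, ∀ v w : EuclideanSpace ℝ (Fin (m + 2)), ‖v‖ ≤ r lam → ‖w‖ ≤ r lam →
      ‖localCov x e lam v w - berryCov (m + 2) 1 v w‖ ≤ η := by
  obtain ⟨C, hC, hcomp⟩ := exists_norm_sphericalFn_sub_waveKernel_le m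
  obtain ⟨δ, hδ, hdil⟩ := exists_norm_waveKernel_dilate_sub_le m (half_pos hη)
  have hε : Tendsto (fun lam => r lam / √lam) atTop (𝓝 0) := hr.tendsto_div_nhds_zero
  have hρ := tendsto_alpha_div_sqrt (m + 2)
  have hexp : ∀ a : ℝ, Tendsto (fun lam => Real.exp (a * (r lam / √lam))) atTop (𝓝 1) := fun a => by
    simpa [Function.comp_def] using (Real.continuous_exp.tendsto _).comp (hε.const_mul a)
  -- the two bounds between which the dilation factor `κ` lies
  have hlow : Tendsto (fun lam => alpha (m + 2) lam / √lam * Real.exp (-3 * (r lam / √lam)))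
      atTop (𝓝 1) := by simpa using hρ.mul (hexp (-3))
  have hup : Tendsto (fun lam => alpha (m + 2) lam / √lam * Real.exp (1 * (r lam / √lam)))
      atTop (𝓝 1) := by simpa using hρ.mul (hexp 1)
  have herr : Tendsto (fun lam => C * (Real.exp ((3 * m + 4) * 6 * (r lam / √lam)) - 1))
      atTop (𝓝 0) := by simpa using ((hexp ((3 * m + 4) * 6)).sub_const 1).const_mul C
  filter_upwards [eventually_gt_atTop 0, hε.eventually_le_const one_pos,
    hlow.eventually_const_le (by linarith : 1 - δ < 1),
    hup.eventually_le_const (by linarith : 1 < 1 + δ),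
    herr.eventually_le_const (half_pos hη)] with lam hlam hε1 hl hu he v w hv hw
  rw [one_mul] at hu
  have hsq : 0 < √lam := Real.sqrt_pos.2 hlam
  set ε := r lam / √lam with hεdef
  have hnorm : ∀ u : EuclideanSpace ℝ (Fin (m + 2)), ‖e ((√lam)⁻¹ • u)‖ = ‖u‖ / √lam := fun u => by
    rw [LinearIsometryEquiv.norm_map, norm_smul, norm_inv, Real.norm_of_nonneg hsq.le,
      inv_mul_eq_div]
  have hpv : ‖e ((√lam)⁻¹ • v)‖ ≤ ε := by
    rw [hnorm, hεdef]
    gcongr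
  have hpw : ‖e ((√lam)⁻¹ • w)‖ ≤ ε := by
    rw [hnorm, hεdef]
    gcongr
  have hdiff : ‖e ((√lam)⁻¹ • v) - e ((√lam)⁻¹ • w)‖ = ‖v - w‖ / √lam := by
    rw [← map_sub, ← smul_sub, hnorm]
  obtain ⟨hd1, hd2⟩ := hdist_expMap_mem_Icc x _ _ hε1 hpv hpw
  have hDε : ‖v - w‖ / √lam ≤ 2 * ε := by
    rw [← hdiff]
    exact (norm_sub_le _ _).trans (by linarith)
  rw [berryCov_one_eq_waveKernel, localCov]
  rw [hdiff] at hd1 hd2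
  generalize hdist (expMap x (e ((√lam)⁻¹ • v))) (expMap x (e ((√lam)⁻¹ • w))) = d at hd1 hd2 ⊢
  have hd0 : 0 ≤ d := le_trans (by positivity) hd1
  have hα : 0 ≤ alpha (m + 2) lam := Real.sqrt_nonneg _
  have hd6 : d ≤ 6 * ε := by
    have hexp3 : Real.exp ε ≤ 3 :=
      (Real.exp_le_exp.2 hε1).trans (by linarith [Real.exp_one_lt_d9])
    exact hd2.trans ((mul_le_mul hexp3 hDε (by positivity) (by norm_num)).trans_eq (by ring))
  have hfirst : ‖sphericalFn (m + 2) lam d - waveKernel m (alpha (m + 2) lam * d)‖ ≤ η / 2 := by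
    refine (hcomp lam d hd0).trans (le_trans ?_ he)
    gcongr C * (Real.exp ?_ - 1)
    rw [mul_assoc]
    gcongr
  have hsecond : ‖waveKernel m (alpha (m + 2) lam * d) - waveKernel m ‖v - w‖‖ ≤ η / 2 := by
    rcases eq_or_ne ‖v - w‖ 0 with h0 | h0
    · rw [h0, zero_div, mul_zero] at hd2
      rw [h0, le_antisymm hd2 hd0, mul_zero, sub_self, norm_zero]
      exact (half_pos hη).le
    have hD : 0 < ‖v - w‖ := lt_of_le_of_ne (norm_nonneg _) h0.symm
    have hκ : alpha (m + 2) lam * d = alpha (m + 2) lam * d / ‖v - w‖ * ‖v - w‖ := by field_simp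
    rw [hκ]
    refine hdil _ (abs_le.2 ⟨?_, ?_⟩) _ hD.le
    · suffices 1 - δ ≤ alpha (m + 2) lam * d / ‖v - w‖ by linarith
      refine hl.trans ?_
      rw [le_div_iff₀ hD]
      calc alpha (m + 2) lam / √lam * Real.exp (-3 * ε) * ‖v - w‖
          = alpha (m + 2) lam * (Real.exp (-3 * ε) * (‖v - w‖ / √lam)) := by ring
        _ ≤ alpha (m + 2) lam * d := by gcongr
    · suffices alpha (m + 2) lam * d / ‖v - w‖ ≤ 1 + δ by linarith
      refine le_trans ?_ hu
      rw [div_le_iff₀ hD]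
      calc alpha (m + 2) lam * d ≤ alpha (m + 2) lam * (Real.exp ε * (‖v - w‖ / √lam)) := by gcongr
        _ = alpha (m + 2) lam / √lam * Real.exp ε * ‖v - w‖ := by ring
  calc _ ≤ _ := norm_sub_le_norm_sub_add_norm_sub _ (waveKernel m (alpha (m + 2) lam * d)) _
    _ ≤ η := by linarith

theorem IsHyperbolicRandomWave.covariance_eq {n : ℕ} {lam : ℝ} {Ω : Type*} [MeasurableSpace Ω]
    {P : Measure Ω} {u : Hyp n → Ω → ℝ} (hu : IsHyperbolicRandomWave n lam P u) (y z : Hyp n) :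
    ((ProbabilityTheory.covariance (u y) (u z) P : ℝ) : ℂ) = sphericalFn n lam (hdist y z) := by
  rw [← hu.covariance, ProbabilityTheory.covariance]
  simp only [hu.mean_zero, sub_zero]

end HypWave

end

theorem mainTheorem7 (n : ℕ) (hn : 2 ≤ n) (x : HypWave.Hyp n)
    (e : EuclideanSpace ℝ (Fin n) ≃ₗᵢ[ℝ] HypWave.Tangent x)
    (r : ℝ → ℝ) (hr : r =o[atTop] Real.sqrt) :
    (∀ lam : ℝ, HypWave.sigma n ^ 2 ≤ lam →
      ∀ (Ω : Type*) [MeasurableSpace Ω] (P : Measure Ω) [IsProbabilityMeasure P]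
        (u : HypWave.Hyp n → Ω → ℝ), HypWave.IsHyperbolicRandomWave n lam P u →
      ∀ v w : EuclideanSpace ℝ (Fin n),
        ((covariance (u (HypWave.expMap x (e ((Real.sqrt lam)⁻¹ • v))))
            (u (HypWave.expMap x (e ((Real.sqrt lam)⁻¹ • w)))) P : ℝ) : ℂ)
          = HypWave.localCov x e lam v w) ∧
    Tendsto (fun lam : ℝ => ⨆ v ∈ Metric.ball (0 : EuclideanSpace ℝ (Fin n)) (r lam),
        ⨆ w ∈ Metric.ball (0 : EuclideanSpace ℝ (Fin n)) (r lam),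
          ‖HypWave.localCov x e lam v w - HypWave.berryCov n 1 v w‖ₑ) atTop (𝓝 0) ∧
    (∀ v w : EuclideanSpace ℝ (Fin n), v ≠ w →
      HypWave.berryCov n 1 v w =
        (((2 * Real.pi) ^ ((n : ℝ) / 2) / HypWave.sphereArea n * ‖v - w‖ ^ (1 - (n : ℝ) / 2) *
          HypWave.besselJ ((n : ℝ) / 2 - 1) ‖v - w‖ : ℝ) : ℂ)) := by
  obtain ⟨m, rfl⟩ : ∃ m, n = m + 2 := ⟨n - 2, by omega⟩
  refine ⟨fun lam _ Ω _ P _ u hu v w => hu.covariance_eq _ _, ?_,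
    fun v w hvw => HypWave.berryCov_one_eq_besselJ m v w hvw⟩
  rw [ENNReal.tendsto_nhds_zero]
  intro ε hε
  obtain ⟨η, hη0, hηε⟩ := ENNReal.lt_iff_exists_nnreal_btwn.1 hε
  filter_upwards [HypWave.eventually_norm_localCov_sub_berryCov_le m x e hr
    (NNReal.coe_pos.2 (ENNReal.coe_pos.1 hη0))] with lam hlam
  refine iSup₂_le fun v hv => iSup₂_le fun w hw => le_trans ?_ hηε.le
  rw [enorm_le_coe]
  exact hlam v w (mem_ball_zero_iff.1 hv).le (mem_ball_zero_iff.1 hw).le
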